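/- Let $d\ge 1$ and let $\mathcal L_0$ be a Lindbladian on $M_d(\mathbb C)$ with effective Hamiltonian $H_0=H_0^\dagger$ and a finite family of Lindblad operators $(L_\alpha)_\alpha$, that is, $\mathcal L_0(X)=-i[H_0,X]+\mathcal D(X)$ with $$\mathcal D(X)=\sum_\alpha\Big(L_\alpha XL_\alpha^\dagger-\tfrac12\big(L_\alpha^\dagger L_\alpha X+XL_\alpha^\dagger L_\alpha\big)\Big).$$ Assume that $\mathcal L_0$ is unital, $\mathcal L_0(I)=0$, and that its dissipative part does not vanish, $\mathcal D\neq 0$ (for $H_0=0$ this says $\mathcal L_0\ne0$; it forces $d\ge 2$). A state is a positive semidefinite $d\times d$ matrix of trace $1$. Write $\rho\succ\sigma$ if, for every $k$, the sum of the $k$ largest eigenvalues of $\rho$ (with multiplicity) is at least the sum of the $k$ largest eigenvalues of $\sigma$. Say that $\rho$ can be converted to $\sigma$ under $\mathcal L_0$ and coherent control if for every $\varepsilon>0$ there are $T\ge 0$, a continuous function $H$ from $[0,T]$ to the traceless Hermitian matrices (with no bound on its size), and a solution of $$\dot\rho(t)=-i[H(t),\rho(t)]+\mathcal L_0(\rho(t)),\qquad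 \rho(0)=\rho,$$ on $[0,T]$ with $\|\rho(T)-\sigma\|<\varepsilon$. Call $\mathcal L_0$ optimal if $\rho$ can be converted to $\sigma$ for all states with $\rho\succ\sigma$. Then $\mathcal L_0$ is optimal if and only if there is an ordered orthonormal basis of $\mathbb C^d$ (the same for all $\alpha$) in which every Lindblad operator has the form $L_\alpha=M_\alpha\oplus D_\alpha$, where $M_\alpha$ is a $2\times2$ matrix and $D_\alpha$ is a diagonal $(d-2)\times(d-2)$ matrix. -/

import Mathlib

open Matrix
open scoped ComplexOrder

/-- The dissipative part
`X ↦ ∑ α, (L_α X L_α† - (1/2) (L_α† L_α X + X L_α† L_α))` of a Lindbladian. -/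
noncomputable def dissipator {d : ℕ} {ι : Type*} [Fintype ι]
    (L : ι → Matrix (Fin d) (Fin d) ℂ) :
    Matrix (Fin d) (Fin d) ℂ →ₗ[ℂ] Matrix (Fin d) (Fin d) ℂ where
  toFun X := ∑ α, (L α * X * (L α)ᴴ -
    (1 / 2 : ℂ) • ((L α)ᴴ * L α * X + X * ((L α)ᴴ * L α)))
  map_add' X Y := by
    rw [← Finset.sum_add_distrib]
    refine Finset.sum_congr rfl fun α _ => ?_
    simp only [Matrix.mul_add, Matrix.add_mul, smul_add]
    abel
  map_smul' c X := by
    simp only [RingHom.id_apply, Finset.smul_sum]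
    refine Finset.sum_congr rfl fun α _ => ?_
    simp only [Matrix.mul_smul, Matrix.smul_mul, smul_sub, smul_add, smul_comm c]

/-- The Hamiltonian superoperator `X ↦ -i [H, X]`. -/
noncomputable def hamiltonianPart {d : ℕ} (H : Matrix (Fin d) (Fin d) ℂ) :
    Matrix (Fin d) (Fin d) ℂ →ₗ[ℂ] Matrix (Fin d) (Fin d) ℂ where
  toFun X := (-Complex.I) • (H * X - X * H)
  map_add' X Y := by
    rw [← smul_add, Matrix.mul_add, Matrix.add_mul]
    congr 1
    abel
  map_smul' c X := by
    simp only [RingHom.id_apply, Matrix.mul_smul, Matrix.smul_mul, smul_sub, smul_comm c]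

/-- The Lindbladian with effective Hamiltonian `H` and Lindblad operators `L α`. -/
noncomputable def lindbladian {d : ℕ} {ι : Type*} [Fintype ι]
    (H : Matrix (Fin d) (Fin d) ℂ) (L : ι → Matrix (Fin d) (Fin d) ℂ) :
    Matrix (Fin d) (Fin d) ℂ →ₗ[ℂ] Matrix (Fin d) (Fin d) ℂ :=
  hamiltonianPart H + dissipator L

/-- A generator is unital if it annihilates the identity. -/
def IsUnital {d : ℕ}
    (G : Matrix (Fin d) (Fin d) ℂ →ₗ[ℂ] Matrix (Fin d) (Fin d) ℂ) : Prop :=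
  G 1 = 0

/-- Quantum states on `ℂ^d`: positive semidefinite matrices of unit trace. -/
structure QState (d : ℕ) where
  mat : Matrix (Fin d) (Fin d) ℂ
  posSemidef : mat.PosSemidef
  trace_eq_one : mat.trace = 1

/-- `ρ ≻ σ`: for every `k`, the sum of the `k` largest eigenvalues of `ρ` is at least the sum of
the `k` largest eigenvalues of `σ`. (`eigenvalues₀` lists the eigenvalues with multiplicity in
decreasing order; both lists add up to `1`.) -/
def QState.Majorizes {d : ℕ} (ρ σ : QState d) : Prop :=
  ∀ k : ℕ,
    ∑ i with i.val < k, σ.posSemidef.isHermitian.eigenvalues₀ i ≤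
      ∑ i with i.val < k, ρ.posSemidef.isHermitian.eigenvalues₀ i

/-- The matrices `x T` at the end of a controlled evolution
`x' = -i [H(t), x] + G x`, `x 0 = x₀`, of some finite duration `T ≥ 0`, where the control `H` is
an arbitrary continuous function with values in the traceless Hermitian matrices. -/
def reachableSet {d : ℕ}
    (G : Matrix (Fin d) (Fin d) ℂ →ₗ[ℂ] Matrix (Fin d) (Fin d) ℂ)
    (x₀ : Matrix (Fin d) (Fin d) ℂ) : Set (Matrix (Fin d) (Fin d) ℂ) :=
  {y | ∃ (T : ℝ) (H x : ℝ → Matrix (Fin d) (Fin d) ℂ),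
    0 ≤ T ∧
    ContinuousOn H (Set.Icc 0 T) ∧
    (∀ t ∈ Set.Icc 0 T, (H t).IsHermitian ∧ (H t).trace = 0) ∧
    (∀ t ∈ Set.Icc 0 T, ∀ i j, HasDerivWithinAt (fun s => x s i j)
      ((hamiltonianPart (H t) (x t) + G (x t)) i j) (Set.Icc 0 T) t) ∧
    x 0 = x₀ ∧ x T = y}

/-- `ρ` can be converted to `σ` under the dissipation `G` and coherent control: `σ` can be
approximated arbitrarily well by states reachable from `ρ`. -/
def Convertible {d : ℕ}
    (G : Matrix (Fin d) (Fin d) ℂ →ₗ[ℂ] Matrix (Fin d) (Fin d) ℂ) (ρ σ : QState d) : Prop :=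
  σ.mat ∈ closure (reachableSet G ρ.mat)

/-- Optimality: all conversions allowed by majorization are possible. -/
def IsOptimal {d : ℕ}
    (G : Matrix (Fin d) (Fin d) ℂ →ₗ[ℂ] Matrix (Fin d) (Fin d) ℂ) : Prop :=
  ∀ ρ σ : QState d, ρ.Majorizes σ → Convertible G ρ σ

/-- In some ordered orthonormal basis of `ℂ^d`, the same for all `α`, every `L α` has the form
`M_α ⊕ D_α` with `M_α` a `2 × 2` matrix and `D_α` diagonal of size `d - 2`. (For `d < 2` there is
no basis with this index type.) -/
def HasTwoLevelForm {d : ℕ} {ι : Type*} (L : ι → Matrix (Fin d) (Fin d) ℂ) : Prop :=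
  ∃ b : OrthonormalBasis (Fin 2 ⊕ Fin (d - 2)) ℂ (EuclideanSpace ℂ (Fin d)),
    ∀ α, ∃ (M : Matrix (Fin 2) (Fin 2) ℂ) (D : Fin (d - 2) → ℂ),
      LinearMap.toMatrix b.toBasis b.toBasis (Matrix.toEuclideanLin (L α)) =
        Matrix.fromBlocks M 0 0 (Matrix.diagonal D)

/-! In an eigenbasis of the current state, the dissipation moves the eigenvalues to first order by a
classical master equation with rates `transitionRate`, and no Hamiltonian contributes, however
strong. Unitality makes the total rates into and out of each level equal. Hence the sum of the `k`
largest eigenvalues never increases, and its loss rate is at least the total transition rate across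
the cut below the `k`-th eigenvalue times half the spectral gap there (`cut_flow_le`,
`sum_eigenvalues_decrease`). These sums are maxima of linear functionals by Ky Fan, which replaces
differentiability of the eigenvalues.

Necessity: without a two-level form, compactness of the unitary group bounds the forbidden
transition rates below by some `η > 0`, uniformly over all bases. Take an equidistant spectrum `p`,
and let `q` average its two largest entries. The partial sums of `p` and `q` agree from `k = 2` on,
so on the way to `q` those sums are almost conserved, and all gaps except the first stay open. Every
forbidden transition crosses one of these gaps, so the sums lose weight at a definite rate. The
conversion also takes a definite time, because the purity must drop by a fixed amount and decays at
a bounded relative rate whatever the control. The total loss then exceeds what an accurate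
conversion allows.

Sufficiency: strong short pulses make the closure of the reachable set invariant under all unitary
conjugations (`conj_mem_closure`), so only spectra matter. In a two-level basis with positive
exchange rate (`HasTwoLevelForm.exists_positive_rate`), a constant control cancels the drift and the
coherence created in the block. What remains mixes two chosen eigenvalues, which yields T-transforms
of any strength after permutations and limits. By the argument of Muirhead and of Hardy, Littlewood
and Pólya (`mem_of_majorizes`), T-transforms reach every majorized spectrum. -/

/-- Total weight of the transitions `j → i` caused by a family of Lindblad operators. -/
noncomputable def transitionRate {d : ℕ} {ι : Type*} [Fintype ι]
    (L : ι → Matrix (Fin d) (Fin d) ℂ) (i j : Fin d) : ℝ :=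
  ∑ α, Complex.normSq (L α i j)

/-! ### Algebra of the generator and the classical rates it induces. -/

section Algebra

variable {d : ℕ} {ι : Type*} [Fintype ι]

lemma transitionRate_nonneg (L : ι → Matrix (Fin d) (Fin d) ℂ) (i j : Fin d) :
    0 ≤ transitionRate L i j :=
  Finset.sum_nonneg fun _ _ => Complex.normSq_nonneg _

lemma dissipator_apply (L : ι → Matrix (Fin d) (Fin d) ℂ) (X : Matrix (Fin d) (Fin d) ℂ) :
    dissipator L X = ∑ α, (L α * X * (L α)ᴴ -
      (1 / 2 : ℂ) • ((L α)ᴴ * L α * X + X * ((L α)ᴴ * L α))) := rfl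

lemma hamiltonianPart_apply (H X : Matrix (Fin d) (Fin d) ℂ) :
    hamiltonianPart H X = (-Complex.I) • (H * X - X * H) := rfl

lemma lindbladian_apply (H : Matrix (Fin d) (Fin d) ℂ) (L : ι → Matrix (Fin d) (Fin d) ℂ)
    (X : Matrix (Fin d) (Fin d) ℂ) :
    lindbladian H L X = hamiltonianPart H X + dissipator L X := rfl

lemma hamiltonianPart_add (H K X : Matrix (Fin d) (Fin d) ℂ) :
    hamiltonianPart (H + K) X = hamiltonianPart H X + hamiltonianPart K X := by
  simp only [hamiltonianPart_apply, ← smul_add, Matrix.add_mul, Matrix.mul_add]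
  congr 1; abel

lemma hamiltonianPart_real_smul (c : ℝ) (H X : Matrix (Fin d) (Fin d) ℂ) :
    hamiltonianPart (c • H) X = c • hamiltonianPart H X := by
  simp only [hamiltonianPart_apply, Matrix.smul_mul, Matrix.mul_smul, ← smul_sub]
  rw [smul_comm]

lemma hamiltonianPart_scalar (c : ℂ) (X : Matrix (Fin d) (Fin d) ℂ) :
    hamiltonianPart (c • (1 : Matrix (Fin d) (Fin d) ℂ)) X = 0 := by
  simp [hamiltonianPart_apply]

lemma unitary_cancel_left {U : Matrix (Fin d) (Fin d) ℂ} (hU : U ∈ unitaryGroup (Fin d) ℂ) :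
    Uᴴ * U = 1 := mem_unitaryGroup_iff'.1 hU

lemma unitary_cancel_right {U : Matrix (Fin d) (Fin d) ℂ} (hU : U ∈ unitaryGroup (Fin d) ℂ) :
    U * Uᴴ = 1 := mem_unitaryGroup_iff.1 hU

lemma conjTranspose_mem_unitary {U : Matrix (Fin d) (Fin d) ℂ}
    (hU : U ∈ unitaryGroup (Fin d) ℂ) : Uᴴ ∈ unitaryGroup (Fin d) ℂ :=
  Unitary.star_mem hU

lemma unitary_cancel_left_assoc {U : Matrix (Fin d) (Fin d) ℂ}
    (hU : U ∈ unitaryGroup (Fin d) ℂ) (X : Matrix (Fin d) (Fin d) ℂ) : Uᴴ * (U * X) = X := by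
  rw [← Matrix.mul_assoc, unitary_cancel_left hU, Matrix.one_mul]

lemma unitary_cancel_right_assoc {U : Matrix (Fin d) (Fin d) ℂ}
    (hU : U ∈ unitaryGroup (Fin d) ℂ) (X : Matrix (Fin d) (Fin d) ℂ) : U * (Uᴴ * X) = X := by
  rw [← Matrix.mul_assoc, unitary_cancel_right hU, Matrix.one_mul]

/-- A change of orthonormal basis only replaces each `L α` by its matrix in the new basis, so every
computation can be made where the state is diagonal. -/
lemma dissipator_conj (L : ι → Matrix (Fin d) (Fin d) ℂ) {U : Matrix (Fin d) (Fin d) ℂ}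
    (hU : U ∈ unitaryGroup (Fin d) ℂ) (X : Matrix (Fin d) (Fin d) ℂ) :
    dissipator L (U * X * Uᴴ) = U * dissipator (fun α => Uᴴ * L α * U) X * Uᴴ := by
  simp only [dissipator_apply, Matrix.mul_sum, Matrix.sum_mul]
  refine Finset.sum_congr rfl fun α _ => ?_
  simp only [Matrix.mul_sub, Matrix.sub_mul, Matrix.mul_smul, Matrix.smul_mul, Matrix.mul_add,
    Matrix.add_mul, conjTranspose_mul, conjTranspose_conjTranspose, Matrix.mul_assoc,
    unitary_cancel_right_assoc hU, unitary_cancel_right hU, Matrix.mul_one]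

lemma hamiltonianPart_conj (H : Matrix (Fin d) (Fin d) ℂ) {U : Matrix (Fin d) (Fin d) ℂ}
    (hU : U ∈ unitaryGroup (Fin d) ℂ) (X : Matrix (Fin d) (Fin d) ℂ) :
    hamiltonianPart H (U * X * Uᴴ) = U * hamiltonianPart (Uᴴ * H * U) X * Uᴴ := by
  simp only [hamiltonianPart_apply, Matrix.mul_sub, Matrix.sub_mul, Matrix.mul_smul,
    Matrix.smul_mul, Matrix.mul_assoc, unitary_cancel_right_assoc hU,
    unitary_cancel_right hU, Matrix.mul_one]

lemma dissipator_conjTranspose (L : ι → Matrix (Fin d) (Fin d) ℂ)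
    (X : Matrix (Fin d) (Fin d) ℂ) : (dissipator L X)ᴴ = dissipator L Xᴴ := by
  simp only [dissipator_apply, conjTranspose_sum]
  refine Finset.sum_congr rfl fun α _ => ?_
  simp [Matrix.mul_assoc, add_comm]

lemma hamiltonianPart_conjTranspose {H : Matrix (Fin d) (Fin d) ℂ} (hH : H.IsHermitian)
    (X : Matrix (Fin d) (Fin d) ℂ) : (hamiltonianPart H X)ᴴ = hamiltonianPart H Xᴴ := by
  simp only [hamiltonianPart_apply, conjTranspose_smul, conjTranspose_sub, conjTranspose_mul,
    hH.eq]
  rw [← neg_sub (H * Xᴴ), smul_neg, ← neg_smul]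
  simp

lemma dissipator_one_of_isUnital {H : Matrix (Fin d) (Fin d) ℂ}
    {L : ι → Matrix (Fin d) (Fin d) ℂ} (h : IsUnital (lindbladian H L)) :
    dissipator L 1 = 0 := by
  have h1 : lindbladian H L 1 = 0 := h
  simpa [lindbladian_apply, hamiltonianPart_apply] using h1

lemma dissipator_one_conj {L : ι → Matrix (Fin d) (Fin d) ℂ} (h : dissipator L 1 = 0)
    {U : Matrix (Fin d) (Fin d) ℂ} (hU : U ∈ unitaryGroup (Fin d) ℂ) :
    dissipator (fun α => Uᴴ * L α * U) 1 = 0 := by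
  have h1 := dissipator_conj L hU 1
  rw [Matrix.mul_one, unitary_cancel_right hU, h] at h1
  calc dissipator (fun α => Uᴴ * L α * U) 1
      = Uᴴ * (U * dissipator (fun α => Uᴴ * L α * U) 1 * Uᴴ) * U := by
        simp only [Matrix.mul_assoc, unitary_cancel_left hU, Matrix.mul_one,
          unitary_cancel_left_assoc hU]
    _ = 0 := by rw [← h1]; simp

lemma dissipator_diagonal_apply (L : ι → Matrix (Fin d) (Fin d) ℂ) (v : Fin d → ℂ)
    (i j : Fin d) :
    dissipator L (diagonal v) i j = ∑ α, ((∑ k, L α i k * v k * star (L α j k)) -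
      (1 / 2 : ℂ) * ((v i + v j) * ∑ k, star (L α k i) * L α k j)) := by
  rw [dissipator_apply, Matrix.sum_apply]
  refine Finset.sum_congr rfl fun α _ => ?_
  rw [Matrix.sub_apply, Matrix.smul_apply, Matrix.add_apply, Matrix.mul_diagonal,
    Matrix.diagonal_mul, smul_eq_mul]
  congr 1
  · simp [Matrix.mul_apply, Matrix.diagonal_apply]
  · simp only [Matrix.mul_apply, conjTranspose_apply]
    ring

/-- Coherences do not enter to first order: the populations of a diagonal matrix obey a master
equation, gain minus loss. -/
lemma dissipator_diagonal_diag (L : ι → Matrix (Fin d) (Fin d) ℂ) (v : Fin d → ℝ) (i : Fin d) :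
    dissipator L (diagonal fun k => (v k : ℂ)) i i =
      ((∑ j, (transitionRate L i j * v j - transitionRate L j i * v i) : ℝ) : ℂ) := by
  rw [dissipator_diagonal_apply]
  simp only [transitionRate, Finset.sum_sub_distrib, Finset.sum_mul, Complex.ofReal_sub,
    Complex.ofReal_sum, Complex.ofReal_mul]
  congr 1
  · rw [Finset.sum_comm]
    refine Finset.sum_congr rfl fun k _ => Finset.sum_congr rfl fun α _ => ?_
    rw [Complex.normSq_eq_conj_mul_self, Complex.star_def]
    ring
  · rw [Finset.sum_comm]
    refine Finset.sum_congr rfl fun α _ => ?_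
    rw [Finset.mul_sum, Finset.mul_sum]
    refine Finset.sum_congr rfl fun k _ => ?_
    rw [Complex.normSq_eq_conj_mul_self, Complex.star_def]
    ring

/-- The uniform distribution is stationary for the master equation, which balances inflow and
outflow at each level. -/
lemma transitionRate_sum_eq {L : ι → Matrix (Fin d) (Fin d) ℂ} (h : dissipator L 1 = 0)
    (i : Fin d) : ∑ j, transitionRate L i j = ∑ j, transitionRate L j i := by
  have h1 := dissipator_diagonal_diag L (fun _ => 1) i
  have h2 : (diagonal fun _ : Fin d => ((1 : ℝ) : ℂ)) = 1 := by simp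
  rw [h2, h, Matrix.zero_apply] at h1
  have h3 := Complex.ofReal_eq_zero.1 h1.symm
  simpa [Finset.sum_sub_distrib, sub_eq_zero] using h3

/-- The loss of weight of the first `k` levels is bounded below by the flow across the cut. -/
lemma cut_flow_le {L : ι → Matrix (Fin d) (Fin d) ℂ} (h : dissipator L 1 = 0) {v : Fin d → ℝ}
    {k : ℕ} {c δ : ℝ} (hlo : ∀ j : Fin d, j.val < k → c + δ ≤ v j)
    (hhi : ∀ j : Fin d, k ≤ j.val → v j ≤ c - δ) :
    δ * ∑ i : Fin d, ∑ j : Fin d,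
        (if (i.val < k) ↔ (j.val < k) then 0 else transitionRate L i j) ≤
      -∑ i : Fin d with i.val < k,
        (dissipator L (diagonal fun k => (v k : ℂ)) i i).re := by
  set n : Fin d → ℝ := fun i => if i.val < k then 1 else 0 with hn
  have e1 : ∑ i : Fin d with i.val < k, (dissipator L (diagonal fun k => (v k : ℂ)) i i).re =
      ∑ i, ∑ j, n i * (transitionRate L i j * v j) - ∑ i, ∑ j, n i * (transitionRate L j i * v i) := by
    rw [Finset.sum_filter, ← Finset.sum_sub_distrib]
    refine Finset.sum_congr rfl fun i _ => ?_
    rw [dissipator_diagonal_diag, Complex.ofReal_re, ← Finset.sum_sub_distrib]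
    by_cases hi : i.val < k <;> simp [hn, hi]
  have e2 : ∑ i, ∑ j, transitionRate L i j * (n j * c) = ∑ i, ∑ j, transitionRate L i j * (n i * c) := by
    rw [Finset.sum_comm]
    refine Finset.sum_congr rfl fun i _ => ?_
    rw [← Finset.sum_mul, ← Finset.sum_mul, transitionRate_sum_eq h]
  have e3 : ∑ i, ∑ j, n i * (transitionRate L j i * v i) =
      ∑ i, ∑ j, transitionRate L i j * (n j * v j) := by
    rw [Finset.sum_comm]
    exact Finset.sum_congr rfl fun i _ => Finset.sum_congr rfl fun j _ => by ring
  -- By the balance of rates (`e2`), the threshold `c` can be subtracted from `v` for free. Then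
  -- only pairs separated by the cut contribute, each with a factor at least `δ`.
  have e4 : -(∑ i, ∑ j, n i * (transitionRate L i j * v j) -
      ∑ i, ∑ j, n i * (transitionRate L j i * v i)) =
      ∑ i, ∑ j, transitionRate L i j * ((v j - c) * (n j - n i)) := by
    have : ∑ i, ∑ j, transitionRate L i j * ((v j - c) * (n j - n i)) =
      ∑ i, ∑ j, transitionRate L i j * (n j * v j) - ∑ i, ∑ j, n i * (transitionRate L i j * v j)
      - (∑ i, ∑ j, transitionRate L i j * (n j * c) -
        ∑ i, ∑ j, transitionRate L i j * (n i * c)) := by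
      simp only [← Finset.sum_sub_distrib]
      exact Finset.sum_congr rfl fun i _ => Finset.sum_congr rfl fun j _ => by ring
    rw [this, e2, e3]
    ring
  rw [e1, e4, Finset.mul_sum]
  refine Finset.sum_le_sum fun i _ => ?_
  rw [Finset.mul_sum]
  refine Finset.sum_le_sum fun j _ => ?_
  have hw := transitionRate_nonneg L i j
  by_cases hi : i.val < k <;> by_cases hj : j.val < k
  · simp [hn, hi, hj]
  · have := hhi j (not_lt.1 hj)
    simp only [hn, hi, hj]
    simp only [iff_false, not_true_eq_false, if_false, if_true]
    nlinarith
  · have := hlo j hj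
    simp only [hn, hi, hj]
    simp only [false_iff, not_true_eq_false, if_false, if_true]
    nlinarith
  · simp [hn, hi, hj]

end Algebra

/-! ### Sums of largest eigenvalues. -/

section KyFan

variable {d : ℕ}

lemma Antitone.exists_cut {v : Fin d → ℝ} (hv : Antitone v) (k : ℕ) :
    ∃ c, (∀ j : Fin d, j.val < k → c ≤ v j) ∧ ∀ j : Fin d, k ≤ j.val → v j ≤ c := by
  by_cases hk : k < d
  · exact ⟨v ⟨k, hk⟩, fun j hj => hv (Fin.le_def.2 hj.le), fun j hj => hv (Fin.le_def.2 hj)⟩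
  -- Here no index lies beyond the cut, so any lower bound of all entries serves.
  · refine ⟨-∑ i, |v i|, fun j _ => ?_, fun j hj => absurd j.isLt (by omega)⟩
    have h1 := Finset.single_le_sum (f := fun i => |v i|) (fun i _ => abs_nonneg _)
      (Finset.mem_univ j)
    have h2 := neg_abs_le (v j)
    linarith

lemma unitary_row_normSq {U : Matrix (Fin d) (Fin d) ℂ} (hU : U ∈ unitaryGroup (Fin d) ℂ)
    (i : Fin d) : ∑ j, Complex.normSq (U i j) = 1 := by
  have h := congr_fun (congr_fun (unitary_cancel_right hU) i) i
  rw [Matrix.mul_apply, Matrix.one_apply_eq] at h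
  have h2 : ((∑ j, Complex.normSq (U i j) : ℝ) : ℂ) = 1 := by
    rw [← h, Complex.ofReal_sum]
    refine Finset.sum_congr rfl fun j _ => ?_
    rw [conjTranspose_apply, Complex.normSq_eq_conj_mul_self, Complex.star_def, mul_comm]
  exact_mod_cast h2

lemma unitary_col_normSq {U : Matrix (Fin d) (Fin d) ℂ} (hU : U ∈ unitaryGroup (Fin d) ℂ)
    (j : Fin d) : ∑ i, Complex.normSq (U i j) = 1 := by
  have h := unitary_row_normSq (conjTranspose_mem_unitary hU) j
  simpa [conjTranspose_apply, Complex.normSq_conj] using h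

lemma conj_diagonal_diag (M : Matrix (Fin d) (Fin d) ℂ) (v : Fin d → ℝ) (i : Fin d) :
    (M * diagonal (fun k => (v k : ℂ)) * Mᴴ) i i = ((∑ j, Complex.normSq (M i j) * v j : ℝ) : ℂ) := by
  rw [Matrix.mul_apply, Complex.ofReal_sum]
  refine Finset.sum_congr rfl fun j _ => ?_
  rw [Matrix.mul_diagonal, conjTranspose_apply, Complex.ofReal_mul,
    Complex.normSq_eq_conj_mul_self, Complex.star_def]
  ring

/-- Ky Fan's maximum principle. -/
lemma sum_diag_conj_le {v : Fin d → ℝ} (hv : Antitone v) {U W : Matrix (Fin d) (Fin d) ℂ}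
    (hU : U ∈ unitaryGroup (Fin d) ℂ) (hW : W ∈ unitaryGroup (Fin d) ℂ) (k : ℕ) :
    ∑ i : Fin d with i.val < k,
      ((Wᴴ * (U * diagonal (fun k => (v k : ℂ)) * Uᴴ) * W) i i).re ≤
      ∑ i : Fin d with i.val < k, v i := by
  obtain ⟨c, hlo, hhi⟩ := hv.exists_cut k
  set M := Wᴴ * U with hM
  have hMu : M ∈ unitaryGroup (Fin d) ℂ := mul_mem (conjTranspose_mem_unitary hW) hU
  have hMX : Wᴴ * (U * diagonal (fun k => (v k : ℂ)) * Uᴴ) * W =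
      M * diagonal (fun k => (v k : ℂ)) * Mᴴ := by
    simp [hM, Matrix.mul_assoc]
  rw [hMX]
  simp only [conj_diagonal_diag, Complex.ofReal_re]
  set n : Fin d → ℝ := fun i => if i.val < k then 1 else 0 with hn
  set D : Fin d → ℝ := fun j => ∑ i : Fin d, n i * Complex.normSq (M i j) with hD
  have hn0 : ∀ i, 0 ≤ n i := fun i => by simp only [hn]; split_ifs <;> norm_num
  have hn1 : ∀ i, n i ≤ 1 := fun i => by simp only [hn]; split_ifs <;> norm_num
  have hD0 : ∀ j, 0 ≤ D j := fun j =>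
    Finset.sum_nonneg fun i _ => mul_nonneg (hn0 i) (Complex.normSq_nonneg _)
  have hD1 : ∀ j, D j ≤ 1 := fun j => by
    rw [← unitary_col_normSq hMu j]
    exact Finset.sum_le_sum fun i _ => by
      nlinarith [hn1 i, Complex.normSq_nonneg (M i j)]
  have hDs : ∑ j, D j = ∑ j, n j := by
    simp only [hD]
    rw [Finset.sum_comm]
    refine Finset.sum_congr rfl fun i _ => ?_
    rw [← Finset.mul_sum, unitary_row_normSq hMu, mul_one]
  have e1 : ∑ i : Fin d with i.val < k, ∑ j, Complex.normSq (M i j) * v j = ∑ j, D j * v j := by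
    rw [Finset.sum_filter]
    simp only [hD, Finset.sum_mul]
    rw [Finset.sum_comm]
    refine Finset.sum_congr rfl fun i _ => ?_
    by_cases hi : i.val < k <;> simp [hn, hi]
  have e2 : ∑ i : Fin d with i.val < k, v i = ∑ j, n j * v j := by
    rw [Finset.sum_filter]
    refine Finset.sum_congr rfl fun i _ => ?_
    by_cases hi : i.val < k <;> simp [hn, hi]
  rw [e1, e2]
  -- The weights `D` lie in `[0, 1]` and have the same total as the indicator `n`, so subtracting
  -- `c` is free and every remaining term is nonpositive.
  have e3 : ∑ j, D j * v j - ∑ j, n j * v j = ∑ j, (D j - n j) * (v j - c) := by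
    have : ∑ j, (D j - n j) * (v j - c) =
        (∑ j, D j * v j - ∑ j, n j * v j) - (∑ j, D j - ∑ j, n j) * c := by
      simp only [← Finset.sum_sub_distrib, Finset.sum_mul]
      exact Finset.sum_congr rfl fun j _ => by ring
    rw [this, hDs]; ring
  have e4 : ∑ j, (D j - n j) * (v j - c) ≤ 0 := by
    refine Finset.sum_nonpos fun j _ => ?_
    by_cases hj : j.val < k
    · have h1 := hlo j hj
      have h2 : n j = 1 := by simp [hn, hj]
      rw [h2]
      nlinarith [hD1 j]
    · have h1 := hhi j (not_lt.1 hj)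
      have h2 : n j = 0 := by simp [hn, hj]
      rw [h2]
      nlinarith [hD0 j]
  linarith

lemma conj_conj_diagonal {U : Matrix (Fin d) (Fin d) ℂ} (hU : U ∈ unitaryGroup (Fin d) ℂ)
    (X : Matrix (Fin d) (Fin d) ℂ) : Uᴴ * (U * X * Uᴴ) * U = X := by
  simp only [Matrix.mul_assoc, unitary_cancel_left hU, Matrix.mul_one,
    unitary_cancel_left_assoc hU]

lemma Matrix.IsHermitian.exists_sorted_spectral {A : Matrix (Fin d) (Fin d) ℂ}
    (hA : A.IsHermitian) : ∃ U ∈ unitaryGroup (Fin d) ℂ, ∃ v : Fin d → ℝ, Antitone v ∧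
      A = U * diagonal (fun k => (v k : ℂ)) * Uᴴ ∧
      ∀ k : ℕ, ∑ i : Fin d with i.val < k, v i =
        ∑ i with i.val < k, hA.eigenvalues₀ i := by
  -- This is the unspecified equivalence by which `eigenvalues` is indexed; permuting the
  -- eigenvectors by `s` undoes it and restores the decreasing order.
  set e := Fintype.equivOfCardEq (Fintype.card_fin (Fintype.card (Fin d))) with he
  set g : Fin d ≃ Fin (Fintype.card (Fin d)) := (finCongr (Fintype.card_fin d)).symm with hg
  set s : Fin d ≃ Fin d := g.trans e with hs
  set V := (hA.eigenvectorUnitary : Matrix (Fin d) (Fin d) ℂ) with hV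
  have hVu : V ∈ unitaryGroup (Fin d) ℂ := hA.eigenvectorUnitary.2
  have hspec : A = V * diagonal (fun k => (hA.eigenvalues k : ℂ)) * Vᴴ := by
    have := hA.spectral_theorem
    exact this
  refine ⟨V.submatrix id s, ?_, fun i => hA.eigenvalues₀ (g i), ?_, ?_, ?_⟩
  · rw [mem_unitaryGroup_iff (A := V.submatrix id s), star_eq_conjTranspose, conjTranspose_submatrix,
      Matrix.submatrix_mul_equiv, unitary_cancel_right hVu]
    simp
  · intro i j hij
    exact hA.eigenvalues₀_antitone (show g i ≤ g j from hij)
  · have hv : (diagonal (fun i => (hA.eigenvalues₀ (g i) : ℂ))) =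
        (diagonal (fun k => (hA.eigenvalues k : ℂ))).submatrix s s := by
      rw [Matrix.submatrix_diagonal_equiv]
      congr 1
      funext i
      simp [Matrix.IsHermitian.eigenvalues, hs, he]
    rw [hv, conjTranspose_submatrix, Matrix.submatrix_mul_equiv, Matrix.submatrix_mul_equiv,
      ← hspec]
    simp
  · intro k
    rw [Finset.sum_filter, Finset.sum_filter]
    refine Fintype.sum_equiv g _ _ fun i => ?_
    simp [hg]

/-- Two sorted diagonalizations of one matrix have the same partial sums, by Ky Fan's inequality in
both directions. -/
lemma Matrix.IsHermitian.sum_eigenvalues₀_eq {A : Matrix (Fin d) (Fin d) ℂ}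
    (hA : A.IsHermitian) {U : Matrix (Fin d) (Fin d) ℂ} (hU : U ∈ unitaryGroup (Fin d) ℂ)
    {v : Fin d → ℝ} (hv : Antitone v) (h : A = U * diagonal (fun k => (v k : ℂ)) * Uᴴ) (k : ℕ) :
    ∑ i with i.val < k, hA.eigenvalues₀ i = ∑ i : Fin d with i.val < k, v i := by
  obtain ⟨W, hW, w, hw, hAw, hsum⟩ := hA.exists_sorted_spectral
  rw [← hsum]
  apply le_antisymm
  · have := sum_diag_conj_le hv hU hW k
    rw [← h, hAw, conj_conj_diagonal hW] at this
    simpa using this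
  · have := sum_diag_conj_le hw hW hU k
    rw [← hAw, h, conj_conj_diagonal hU] at this
    simpa using this

end KyFan

/-! ### Monotonicity from supporting functions. -/

section Support

open Set Filter Topology

/-- A function supported from below at every point by functions of slope at most `-η` decreases
at rate at least `η`. -/
lemma add_le_of_lower_support {F : ℝ → ℝ} {a b η : ℝ} (hab : a ≤ b)
    (hF : ContinuousOn F (Icc a b))
    (h : ∀ t ∈ Ioc a b, ∃ (l : ℝ → ℝ) (m : ℝ), m ≤ -η ∧ HasDerivWithinAt l m (Icc a b) t ∧
      l t = F t ∧ ∀ s ∈ Icc a b, l s ≤ F s) :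
    F b + η * (b - a) ≤ F a := by
  have hmaps : MapsTo (fun u : ℝ => -u) (Icc (-b) (-a)) (Icc a b) := by
    intro u hu
    constructor <;> [linarith [hu.2]; linarith [hu.1]]
  -- Time is reversed: a support from below at `t` controls the slopes of `F` to the left of `t`,
  -- while the comparison theorem asks for slopes to the right.
  have key := image_le_of_liminf_slope_right_le_deriv_boundary (f := fun u => -F (-u))
    (a := -b) (b := -a) (B := fun u => -F b - η * (u + b)) (B' := fun _ => -η)
    ((hF.comp continuous_neg.continuousOn hmaps).neg) (by simp) (by fun_prop)
    (fun x _ => by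
      have h1 : HasDerivAt (fun u : ℝ => -F b - η * (u + b)) (-(η * 1)) x :=
        (((hasDerivAt_id x).add_const b).const_mul η).const_sub (-F b)
      rw [mul_one] at h1
      exact h1.hasDerivWithinAt) ?_ (show -a ∈ Icc (-b) (-a) from ⟨by linarith, le_rfl⟩)
  · simp only [neg_neg] at key
    linarith
  · intro u hu r hr
    obtain ⟨l, m, hm, hl, hlt, hle⟩ := h (-u) ⟨by linarith [hu.2], by linarith [hu.1]⟩
    have hd : HasDerivWithinAt (fun s => -l (-s)) m (Icc (-b) (-a)) u := by
      have h1 : HasDerivWithinAt (fun s => l (-s)) (m * (-1)) (Icc (-b) (-a)) u :=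
        HasDerivWithinAt.comp u (h₂ := l) (by simpa using hl) (hasDerivWithinAt_neg u _) hmaps
      have h2 := h1.neg
      rw [mul_neg_one, neg_neg] at h2
      exact h2
    have hd2 : HasDerivWithinAt (fun s => -l (-s)) m (Ioi u) u := by
      have h2 : HasDerivWithinAt (fun s => -l (-s)) m (Icc u (-a)) u :=
        hd.mono (Icc_subset_Icc hu.1 le_rfl)
      exact (h2.mono_of_mem_nhdsWithin (Icc_mem_nhdsGE hu.2)).mono Ioi_subset_Ici_self
    have ht := (hasDerivWithinAt_iff_tendsto_slope' (by simp)).1 hd2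
    have hev : ∀ᶠ z in 𝓝[>] u, slope (fun s => -l (-s)) u z < r :=
      ht.eventually_lt_const (lt_of_le_of_lt hm hr)
    have hmem : ∀ᶠ z in 𝓝[>] u, z ∈ Ioo u (-a) := Ioo_mem_nhdsGT hu.2
    refine (hev.and hmem).frequently.mono ?_
    rintro z ⟨hz, hz1, hz2⟩
    refine lt_of_le_of_lt ?_ hz
    rw [slope_def_field, slope_def_field]
    have h3 := hle (-z) ⟨by linarith, by linarith [hu.1]⟩
    have : 0 < z - u := by linarith
    gcongr
    · exact hlt.ge

end Support

/-! ### Spectrum and purity along controlled trajectories. -/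

section Trajectories

open Set Filter Topology

variable {d : ℕ} {ι : Type*} [Fintype ι]

/-- Expanding `φ` in matrix units reduces to entrywise derivatives, so no norm on matrices has to be
chosen. -/
lemma hasDerivWithinAt_linearMap_matrix {E : Type*} [NormedAddCommGroup E] [NormedSpace ℝ E]
    {x : ℝ → Matrix (Fin d) (Fin d) ℂ} {v : Matrix (Fin d) (Fin d) ℂ} {S : Set ℝ} {t : ℝ}
    (h : ∀ i j, HasDerivWithinAt (fun s => x s i j) (v i j) S t)
    (φ : Matrix (Fin d) (Fin d) ℂ →ₗ[ℝ] E) :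
    HasDerivWithinAt (fun s => φ (x s)) (φ v) S t := by
  have e : ∀ X : Matrix (Fin d) (Fin d) ℂ, φ X = ∑ i, ∑ j,
      LinearMap.toContinuousLinearMap (φ ∘ₗ Matrix.singleLinearMap ℝ i j) (X i j) := by
    intro X
    conv_lhs => rw [Matrix.matrix_eq_sum_single X]
    simp [map_sum]
  simp only [e]
  exact HasDerivWithinAt.fun_sum fun i _ => HasDerivWithinAt.fun_sum fun j _ =>
    (ContinuousLinearMap.hasFDerivAt _).comp_hasDerivWithinAt t (h i j)

/-- The sum of the first `k` diagonal entries in the basis of the columns of `U`. -/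
noncomputable def cutTrace (U : Matrix (Fin d) (Fin d) ℂ) (k : ℕ) :
    Matrix (Fin d) (Fin d) ℂ →ₗ[ℝ] ℝ where
  toFun X := ∑ i : Fin d with i.val < k, ((Uᴴ * X * U) i i).re
  map_add' X Y := by
    simp [Matrix.mul_add, Matrix.add_mul, Finset.sum_add_distrib]
  map_smul' c X := by
    simp [Finset.mul_sum]

lemma cutTrace_apply (U : Matrix (Fin d) (Fin d) ℂ) (k : ℕ) (X : Matrix (Fin d) (Fin d) ℂ) :
    cutTrace U k X = ∑ i : Fin d with i.val < k, ((Uᴴ * X * U) i i).re := rfl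

lemma cutTrace_conj {U : Matrix (Fin d) (Fin d) ℂ} (hU : U ∈ unitaryGroup (Fin d) ℂ) (k : ℕ)
    (X : Matrix (Fin d) (Fin d) ℂ) :
    cutTrace U k (U * X * Uᴴ) = ∑ i : Fin d with i.val < k, (X i i).re := by
  rw [cutTrace_apply, conj_conj_diagonal hU]

lemma abs_cutTrace_le {U : Matrix (Fin d) (Fin d) ℂ} (hU : U ∈ unitaryGroup (Fin d) ℂ) (k : ℕ)
    (X : Matrix (Fin d) (Fin d) ℂ) : |cutTrace U k X| ≤ d * ∑ a, ∑ b, ‖X a b‖ := by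
  have h1 : ∀ i, |((Uᴴ * X * U) i i).re| ≤ ∑ a, ∑ b, ‖X a b‖ := by
    intro i
    refine (Complex.abs_re_le_norm _).trans ?_
    rw [Matrix.mul_apply, Finset.sum_comm]
    refine (norm_sum_le _ _).trans (Finset.sum_le_sum fun b _ => ?_)
    rw [Matrix.mul_apply, Finset.sum_mul]
    refine (norm_sum_le _ _).trans (Finset.sum_le_sum fun a _ => ?_)
    rw [norm_mul, norm_mul, conjTranspose_apply, norm_star]
    have ha := entry_norm_bound_of_unitary hU a i
    have hb := entry_norm_bound_of_unitary hU b i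
    calc ‖U a i‖ * ‖X a b‖ * ‖U b i‖ ≤ 1 * ‖X a b‖ * 1 := by gcongr
      _ = ‖X a b‖ := by ring
  rw [cutTrace_apply]
  calc |∑ i : Fin d with i.val < k, ((Uᴴ * X * U) i i).re|
      ≤ ∑ i : Fin d with i.val < k, |((Uᴴ * X * U) i i).re| := Finset.abs_sum_le_sum_abs _ _
    _ ≤ ∑ i : Fin d, |((Uᴴ * X * U) i i).re| :=
        Finset.sum_le_sum_of_subset_of_nonneg (Finset.filter_subset _ _) fun _ _ _ => abs_nonneg _
    _ ≤ ∑ _i : Fin d, ∑ a, ∑ b, ‖X a b‖ := Finset.sum_le_sum fun i _ => h1 i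
    _ = d * ∑ a, ∑ b, ‖X a b‖ := by simp

/-- Partial eigenvalue sums are Lipschitz: on the first `k` columns of `U` the first matrix has
trace exactly its partial sum, while the second has at most its own by Ky Fan. -/
lemma sum_sub_sum_le {U W : Matrix (Fin d) (Fin d) ℂ} (hU : U ∈ unitaryGroup (Fin d) ℂ)
    (hW : W ∈ unitaryGroup (Fin d) ℂ) {v w : Fin d → ℝ} (hw : Antitone w) (k : ℕ) :
    ∑ i : Fin d with i.val < k, v i - ∑ i : Fin d with i.val < k, w i ≤
      d * ∑ a, ∑ b, ‖(U * diagonal (fun k => (v k : ℂ)) * Uᴴ -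
        W * diagonal (fun k => (w k : ℂ)) * Wᴴ) a b‖ := by
  have h1 := sum_diag_conj_le hw hW hU k
  rw [← cutTrace_apply] at h1
  have h2 := cutTrace_conj hU k (diagonal fun k => (v k : ℂ))
  simp only [diagonal_apply_eq, Complex.ofReal_re] at h2
  have h3 := abs_cutTrace_le hU k (U * diagonal (fun k => (v k : ℂ)) * Uᴴ -
        W * diagonal (fun k => (w k : ℂ)) * Wᴴ)
  rw [map_sub, h2] at h3
  linarith [le_abs_self (∑ i : Fin d with i.val < k, v i -
    cutTrace U k (W * diagonal (fun k => (w k : ℂ)) * Wᴴ))]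

lemma hamiltonianPart_diagonal_diag (H : Matrix (Fin d) (Fin d) ℂ) (v : Fin d → ℂ) (i : Fin d) :
    hamiltonianPart H (diagonal v) i i = 0 := by
  rw [hamiltonianPart_apply, Matrix.smul_apply, Matrix.sub_apply, Matrix.mul_diagonal,
    Matrix.diagonal_mul, mul_comm, sub_self, smul_zero]

/-- Along a controlled trajectory the sums of the largest eigenvalues decrease at least at the
rate given by the dissipation in the instantaneous eigenbasis. -/
lemma sum_eigenvalues_decrease {L : ι → Matrix (Fin d) (Fin d) ℂ} {T : ℝ}
    {K z U : ℝ → Matrix (Fin d) (Fin d) ℂ} {v : ℝ → Fin d → ℝ}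
    (hz : ∀ t ∈ Icc 0 T, ∀ i j, HasDerivWithinAt (fun s => z s i j)
      ((hamiltonianPart (K t) (z t) + dissipator L (z t)) i j) (Icc 0 T) t)
    (hU : ∀ t, U t ∈ unitaryGroup (Fin d) ℂ) (hv : ∀ t, Antitone (v t))
    (hzU : ∀ t, z t = U t * diagonal (fun k => (v t k : ℂ)) * (U t)ᴴ)
    (N : Finset ℕ) {a b η : ℝ} (ha : 0 ≤ a) (hab : a ≤ b) (hb : b ≤ T)
    (hη : ∀ t ∈ Ioc a b, η ≤ ∑ k ∈ N, -∑ i : Fin d with i.val < k,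
      (dissipator (fun α => (U t)ᴴ * L α * U t) (diagonal fun k => (v t k : ℂ)) i i).re) :
    ∑ k ∈ N, ∑ i : Fin d with i.val < k, v b i + η * (b - a) ≤
      ∑ k ∈ N, ∑ i : Fin d with i.val < k, v a i := by
  have hsub : Icc a b ⊆ Icc 0 T := Icc_subset_Icc ha hb
  have key : ∀ F : ℝ → ℝ, (∀ t, F t = ∑ k ∈ N, ∑ i : Fin d with i.val < k, v t i) →
      F b + η * (b - a) ≤ F a := by
    intro F hF
    refine add_le_of_lower_support hab ?_ ?_
    rotate_left
    · intro t ht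
      have ht' : t ∈ Icc 0 T := hsub (Ioc_subset_Icc_self ht)
      -- The supporting function freezes the eigenbasis at time `t`: it agrees with the sum of
      -- eigenvalues there and stays below it elsewhere by Ky Fan.
      refine ⟨fun s => ∑ k ∈ N, cutTrace (U t) k (z s),
        ∑ k ∈ N, cutTrace (U t) k (hamiltonianPart (K t) (z t) + dissipator L (z t)), ?_, ?_, ?_, ?_⟩
      · have h1 : ∀ k, cutTrace (U t) k (hamiltonianPart (K t) (z t) + dissipator L (z t)) =
            ∑ i : Fin d with i.val < k, (dissipator (fun α => (U t)ᴴ * L α * U t)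
              (diagonal fun k => (v t k : ℂ)) i i).re := by
          intro k
          rw [hzU, hamiltonianPart_conj _ (hU t), dissipator_conj _ (hU t), ← Matrix.add_mul,
            ← Matrix.mul_add, cutTrace_conj (hU t)]
          refine Finset.sum_congr rfl fun i _ => ?_
          rw [Matrix.add_apply, hamiltonianPart_diagonal_diag, zero_add]
        simp only [h1]
        have := hη t ht
        rw [Finset.sum_neg_distrib] at this
        linarith
      · exact HasDerivWithinAt.fun_sum fun k _ =>
          (hasDerivWithinAt_linearMap_matrix (hz t ht') _).mono hsub
      · rw [hF]
        refine Finset.sum_congr rfl fun k _ => ?_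
        rw [hzU, cutTrace_conj (hU t)]
        simp
      · intro s _
        rw [hF]
        refine Finset.sum_le_sum fun k _ => ?_
        rw [cutTrace_apply, hzU s]
        exact sum_diag_conj_le (hv s) (hU s) (hU t) k
    · rw [funext hF]
      refine continuousOn_finsetSum _ fun k _ => ?_
      intro t ht
      have hlim : Tendsto (fun s => (d : ℝ) * ∑ a, ∑ b, ‖(z s - z t) a b‖) (𝓝[Icc a b] t) (𝓝 0) := by
        have h0 : (0 : ℝ) = d * ∑ a : Fin d, ∑ b : Fin d, ‖(z t - z t) a b‖ := by simp
        rw [h0]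
        refine Tendsto.const_mul _ (tendsto_finsetSum _ fun i _ => tendsto_finsetSum _ fun j _ => ?_)
        exact (((hz t (hsub ht) i j).continuousWithinAt.mono hsub).tendsto.sub_const _).norm
      rw [ContinuousWithinAt, tendsto_iff_norm_sub_tendsto_zero]
      refine squeeze_zero (fun _ => norm_nonneg _) (fun s => ?_) hlim
      rw [Real.norm_eq_abs, abs_le]
      have h1 := sum_sub_sum_le (hU s) (hU t) (v := v s) (hv t) k
      have h2 := sum_sub_sum_le (hU t) (hU s) (v := v t) (hv s) k
      rw [← hzU, ← hzU] at h1 h2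
      have h3 : ∑ a, ∑ b, ‖(z t - z s) a b‖ = ∑ a, ∑ b, ‖(z s - z t) a b‖ :=
        Finset.sum_congr rfl fun i _ => Finset.sum_congr rfl fun j _ => by
          rw [Matrix.sub_apply, Matrix.sub_apply, norm_sub_rev]
      rw [h3] at h2
      exact ⟨by linarith, h1⟩
  exact key _ fun _ => rfl

lemma sum_normSq_eq_trace (M : Matrix (Fin d) (Fin d) ℂ) :
    ((∑ i, ∑ j, Complex.normSq (M i j) : ℝ) : ℂ) = (Mᴴ * M).trace := by
  rw [Finset.sum_comm]
  simp only [Matrix.trace, Matrix.diag_apply, Matrix.mul_apply, Complex.ofReal_sum,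
    conjTranspose_apply, Complex.normSq_eq_conj_mul_self, Complex.star_def]

lemma sum_normSq_conj (M : Matrix (Fin d) (Fin d) ℂ) {U : Matrix (Fin d) (Fin d) ℂ}
    (hU : U ∈ unitaryGroup (Fin d) ℂ) :
    ∑ i, ∑ j, Complex.normSq ((Uᴴ * M * U) i j) = ∑ i, ∑ j, Complex.normSq (M i j) := by
  have h : (((Uᴴ * M * U)ᴴ * (Uᴴ * M * U)).trace) = (Mᴴ * M).trace := by
    simp only [conjTranspose_mul, conjTranspose_conjTranspose, Matrix.mul_assoc,
      unitary_cancel_right_assoc hU]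
    rw [Matrix.trace_mul_comm]
    simp only [Matrix.mul_assoc, unitary_cancel_right hU, Matrix.mul_one]
  rw [← sum_normSq_eq_trace, ← sum_normSq_eq_trace] at h
  exact_mod_cast h

lemma sum_transitionRate_conj (L : ι → Matrix (Fin d) (Fin d) ℂ) {U : Matrix (Fin d) (Fin d) ℂ}
    (hU : U ∈ unitaryGroup (Fin d) ℂ) :
    ∑ i, ∑ j, transitionRate (fun α => Uᴴ * L α * U) i j = ∑ i, ∑ j, transitionRate L i j := by
  have h : ∀ L' : ι → Matrix (Fin d) (Fin d) ℂ, ∑ i, ∑ j, transitionRate L' i j =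
      ∑ α, ∑ i, ∑ j, Complex.normSq (L' α i j) := by
    intro L'
    rw [Finset.sum_comm]
    simp only [transitionRate]
    simp_rw [Finset.sum_comm (s := Finset.univ (α := Fin d)) (t := Finset.univ (α := ι))]
    exact Finset.sum_congr rfl fun α _ => Finset.sum_comm
  rw [h, h]
  exact Finset.sum_congr rfl fun α _ => sum_normSq_conj _ hU

/-- This is half the rate of change of the purity. In the eigenbasis each product of two eigenvalues
is bounded by the purity, and the total transition rate is unitarily invariant, so the bound does
not depend on the basis. -/
lemma trace_dissipator_mul_ge (L : ι → Matrix (Fin d) (Fin d) ℂ) (v : Fin d → ℝ)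
    {U : Matrix (Fin d) (Fin d) ℂ} (hU : U ∈ unitaryGroup (Fin d) ℂ) :
    -(2 * (∑ i, ∑ j, transitionRate L i j) * ∑ i, v i ^ 2) ≤
      (dissipator L (U * diagonal (fun k => (v k : ℂ)) * Uᴴ) *
        (U * diagonal (fun k => (v k : ℂ)) * Uᴴ)).trace.re := by
  rw [dissipator_conj L hU, ← sum_transitionRate_conj L hU]
  set L' := fun α => Uᴴ * L α * U
  set S := ∑ i, v i ^ 2
  have h1 : (U * dissipator L' (diagonal fun k => (v k : ℂ)) * Uᴴ *
        (U * diagonal (fun k => (v k : ℂ)) * Uᴴ)).trace =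
      ((∑ i, ∑ j, (transitionRate L' i j * v j - transitionRate L' j i * v i) * v i : ℝ) : ℂ) := by
    simp only [Matrix.mul_assoc, unitary_cancel_left_assoc hU]
    rw [Matrix.trace_mul_comm]
    simp only [Matrix.mul_assoc, unitary_cancel_left hU, Matrix.mul_one]
    simp only [Matrix.trace, Matrix.diag_apply, Matrix.mul_diagonal, dissipator_diagonal_diag]
    rw [Complex.ofReal_sum]
    refine Finset.sum_congr rfl fun i _ => ?_
    rw [← Finset.sum_mul, Complex.ofReal_mul]
  rw [h1, Complex.ofReal_re]
  have h2 : 2 * (∑ i, ∑ j, transitionRate L' i j) * S =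
      ∑ i, ∑ j, (transitionRate L' i j * S + transitionRate L' j i * S) := by
    simp only [Finset.sum_add_distrib]
    rw [Finset.sum_comm (f := fun i j => transitionRate L' j i * S)]
    simp only [← Finset.sum_mul]
    ring
  rw [h2, ← Finset.sum_neg_distrib]
  refine Finset.sum_le_sum fun i _ => ?_
  rw [← Finset.sum_neg_distrib]
  refine Finset.sum_le_sum fun j _ => ?_
  have hS : ∀ i, v i ^ 2 ≤ S := fun i =>
    Finset.single_le_sum (f := fun i => v i ^ 2) (fun i _ => sq_nonneg _) (Finset.mem_univ i)
  have hw := transitionRate_nonneg L' i j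
  have hw' := transitionRate_nonneg L' j i
  have h3 : -S ≤ v j * v i := by nlinarith [hS i, hS j, sq_nonneg (v i + v j)]
  nlinarith [mul_le_mul_of_nonneg_left h3 hw, mul_le_mul_of_nonneg_left (hS i) hw']

lemma trace_hamiltonianPart_mul_self (H X : Matrix (Fin d) (Fin d) ℂ) :
    (hamiltonianPart H X * X).trace = 0 := by
  rw [hamiltonianPart_apply, Matrix.smul_mul, Matrix.trace_smul, Matrix.sub_mul,
    Matrix.trace_sub, Matrix.trace_mul_comm (X * H) X, Matrix.trace_mul_comm (H * X) X,
    ← Matrix.mul_assoc, ← Matrix.mul_assoc, Matrix.mul_assoc X X H,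
    Matrix.trace_mul_comm (X * H) X, sub_self, smul_zero]

/-- The purity decays at most exponentially along a controlled trajectory. -/
lemma purity_lower_bound {L : ι → Matrix (Fin d) (Fin d) ℂ} {T : ℝ} (hT : 0 ≤ T)
    {K z U : ℝ → Matrix (Fin d) (Fin d) ℂ} {v : ℝ → Fin d → ℝ}
    (hz : ∀ t ∈ Icc 0 T, ∀ i j, HasDerivWithinAt (fun s => z s i j)
      ((hamiltonianPart (K t) (z t) + dissipator L (z t)) i j) (Icc 0 T) t)
    (hU : ∀ t, U t ∈ unitaryGroup (Fin d) ℂ)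
    (hzU : ∀ t, z t = U t * diagonal (fun k => (v t k : ℂ)) * (U t)ᴴ) :
    (∑ i, v 0 i ^ 2) * (1 - 4 * (∑ i, ∑ j, transitionRate L i j) * T) ≤ ∑ i, v T i ^ 2 := by
  set W := ∑ i, ∑ j, transitionRate L i j with hW
  set G : ℝ → Matrix (Fin d) (Fin d) ℂ :=
    fun t => hamiltonianPart (K t) (z t) + dissipator L (z t) with hG
  have hP : ∀ t, (z t * z t).trace.re = ∑ i, v t i ^ 2 := by
    intro t
    have : (z t * z t).trace = ((∑ i, v t i ^ 2 : ℝ) : ℂ) := by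
      rw [hzU]
      simp only [Matrix.mul_assoc, unitary_cancel_left_assoc (hU t)]
      rw [Matrix.trace_mul_comm]
      simp only [Matrix.mul_assoc, unitary_cancel_left (hU t), Matrix.mul_one]
      simp [Matrix.trace, sq]
    rw [this, Complex.ofReal_re]
  have hd : ∀ t ∈ Icc 0 T, HasDerivWithinAt (fun s => (z s * z s).trace.re)
      (2 * (G t * z t).trace.re) (Icc 0 T) t := by
    intro t ht
    have h1 : HasDerivWithinAt (fun s => (z s * z s).trace) (∑ i, ∑ j,
        (G t i j * z t j i + z t i j * G t j i)) (Icc 0 T) t := by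
      simp only [Matrix.trace, Matrix.diag_apply, Matrix.mul_apply]
      exact HasDerivWithinAt.fun_sum fun i _ => HasDerivWithinAt.fun_sum fun j _ =>
        (hz t ht i j).mul (hz t ht j i)
    have h2 : ∑ i, ∑ j, (G t i j * z t j i + z t i j * G t j i) = 2 * (G t * z t).trace := by
      have e1 : ∑ i, ∑ j, G t i j * z t j i = (G t * z t).trace := by
        simp [Matrix.trace, Matrix.mul_apply]
      have e2 : ∑ i, ∑ j, z t i j * G t j i = (z t * G t).trace := by
        simp [Matrix.trace, Matrix.mul_apply]
      simp only [Finset.sum_add_distrib]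
      rw [e1, e2, Matrix.trace_mul_comm (z t)]
      ring
    rw [h2] at h1
    have h3 := (Complex.reCLM.hasFDerivAt).comp_hasDerivWithinAt t h1
    simpa [Function.comp_def] using h3
  have hge : ∀ t, -(4 * W * ∑ i, v t i ^ 2) ≤ 2 * (G t * z t).trace.re := by
    intro t
    have h1 := trace_dissipator_mul_ge L (v t) (hU t)
    rw [← hzU] at h1
    have h2 : (G t * z t).trace = (dissipator L (z t) * z t).trace := by
      simp only [hG]
      rw [Matrix.add_mul, Matrix.trace_add, trace_hamiltonianPart_mul_self, zero_add]
    rw [h2]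
    linarith
  -- Purity times the integrating factor `exp (4 W t)` is nondecreasing. As `F` is differentiable,
  -- it serves as its own supporting function.
  set F : ℝ → ℝ := fun t => -((z t * z t).trace.re * Real.exp (4 * W * t)) with hF
  have hFd : ∀ t ∈ Icc 0 T, HasDerivWithinAt F (-(2 * (G t * z t).trace.re * Real.exp (4 * W * t) +
      (z t * z t).trace.re * (Real.exp (4 * W * t) * (4 * W)))) (Icc 0 T) t := by
    intro t ht
    have h1 : HasDerivAt (fun t => Real.exp (4 * W * t)) (Real.exp (4 * W * t) * (4 * W)) t := by
      have := ((hasDerivAt_id t).const_mul (4 * W)).exp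
      simpa using this
    exact ((hd t ht).mul h1.hasDerivWithinAt).neg
  have key := add_le_of_lower_support (F := F) (η := 0) hT
    (fun t ht => (hFd t ht).continuousWithinAt)
    (fun t ht => ⟨F, _, ?_, hFd t (Ioc_subset_Icc_self ht), rfl, fun _ _ => le_rfl⟩)
  · simp only [hF, hP, mul_zero, Real.exp_zero, mul_one, zero_mul, add_zero] at key
    have h1 : 1 - 4 * W * T ≤ Real.exp (-(4 * W * T)) := by
      linarith [Real.add_one_le_exp (-(4 * W * T))]
    have h0 : 0 ≤ ∑ i, v 0 i ^ 2 := Finset.sum_nonneg fun _ _ => sq_nonneg _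
    calc (∑ i, v 0 i ^ 2) * (1 - 4 * W * T) ≤ (∑ i, v 0 i ^ 2) * Real.exp (-(4 * W * T)) := by
          gcongr
      _ ≤ ((∑ i, v T i ^ 2) * Real.exp (4 * W * T)) * Real.exp (-(4 * W * T)) := by
          gcongr; linarith
      _ = ∑ i, v T i ^ 2 := by rw [mul_assoc, ← Real.exp_add]; simp
  · have h1 := hge t
    rw [hP]
    have := Real.exp_pos (4 * W * t)
    nlinarith

end Trajectories

/-! ### Two-level form and a uniform bound on the violation of it. -/

section TwoLevel

open Set Filter Topology

variable {d : ℕ} {ι : Type*}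

/-- Up to the ordered basis, the matrices `L α` are block diagonal with one `2 × 2` block and
`1 × 1` blocks otherwise. -/
def IsTwoLevel (L : ι → Matrix (Fin d) (Fin d) ℂ) : Prop :=
  ∀ α, ∀ i j : Fin d, i ≠ j → ¬(i.val < 2 ∧ j.val < 2) → L α i j = 0

/-- Splitting off the first two basis vectors. -/
def twoLevelEquiv (hd : 2 ≤ d) : Fin 2 ⊕ Fin (d - 2) ≃ Fin d :=
  finSumFinEquiv.trans (finCongr (by omega))

lemma twoLevelEquiv_inl (hd : 2 ≤ d) (i : Fin 2) : (twoLevelEquiv hd (Sum.inl i)).val = i.val := by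
  simp [twoLevelEquiv]

lemma twoLevelEquiv_inr (hd : 2 ≤ d) (i : Fin (d - 2)) :
    (twoLevelEquiv hd (Sum.inr i)).val = 2 + i.val := by
  simp [twoLevelEquiv]

lemma toMatrix_orthonormalBasis {κ : Type*} [Fintype κ] [DecidableEq κ]
    (b : OrthonormalBasis κ ℂ (EuclideanSpace ℂ (Fin d))) (A : Matrix (Fin d) (Fin d) ℂ) :
    LinearMap.toMatrix b.toBasis b.toBasis (Matrix.toEuclideanLin A) =
      (Matrix.of fun a k => b k a)ᴴ * A * Matrix.of fun a k => b k a := by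
  ext r s
  rw [LinearMap.toMatrix_apply, b.coe_toBasis_repr_apply, b.repr_apply_apply,
    OrthonormalBasis.coe_toBasis, Matrix.mul_assoc, Matrix.mul_apply,
    EuclideanSpace.inner_eq_star_dotProduct, dotProduct]
  refine Finset.sum_congr rfl fun a _ => ?_
  simp [Matrix.toLpLin_apply, Matrix.mulVec, dotProduct, Matrix.mul_apply, mul_comm]

lemma hasTwoLevelForm_of_isTwoLevel (hd : 2 ≤ d) {L : ι → Matrix (Fin d) (Fin d) ℂ}
    {U : Matrix (Fin d) (Fin d) ℂ} (hU : U ∈ unitaryGroup (Fin d) ℂ)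
    (h : IsTwoLevel fun α => Uᴴ * L α * U) : HasTwoLevelForm L := by
  set e := twoLevelEquiv hd with he
  have hon : Orthonormal ℂ fun k : Fin 2 ⊕ Fin (d - 2) =>
      (WithLp.toLp 2 fun a => U a (e k) : EuclideanSpace ℂ (Fin d)) := by
    rw [orthonormal_iff_ite]
    intro r s
    have := congr_fun (congr_fun (unitary_cancel_left hU) (e r)) (e s)
    rw [Matrix.mul_apply, Matrix.one_apply] at this
    rw [EuclideanSpace.inner_eq_star_dotProduct, dotProduct]
    simp only [e.injective.eq_iff] at this
    rw [← this]
    exact Finset.sum_congr rfl fun a _ => by simp [mul_comm]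
  -- The family already has full cardinality; with `s = univ` nothing is added and it is only
  -- promoted to a basis.
  obtain ⟨b, hb⟩ := Orthonormal.exists_orthonormalBasis_extension_of_card_eq
    (𝕜 := ℂ) (E := EuclideanSpace ℂ (Fin d)) (ι := Fin 2 ⊕ Fin (d - 2)) (by simp; omega)
    (v := fun k => (WithLp.toLp 2 fun a => U a (e k) : EuclideanSpace ℂ (Fin d)))
    (s := univ) (hon.comp _ Subtype.val_injective)
  have hbU : (Matrix.of fun a k => b k a) = U.submatrix id e := by
    ext a k
    simp [hb k (mem_univ k)]
  refine ⟨b, fun α => ⟨Matrix.of fun i j => (Uᴴ * L α * U) (e (Sum.inl i)) (e (Sum.inl j)),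
    fun i => (Uᴴ * L α * U) (e (Sum.inr i)) (e (Sum.inr i)), ?_⟩⟩
  have hmat : (Matrix.of fun a k => b k a)ᴴ * L α * (Matrix.of fun a k => b k a) =
      (Uᴴ * L α * U).submatrix e e := by
    rw [hbU, conjTranspose_submatrix]
    ext r s
    simp [Matrix.mul_apply]
  rw [toMatrix_orthonormalBasis, hmat]
  ext (r | r) (s | s)
  · simp
  · simp only [submatrix_apply, fromBlocks_apply₁₂, Matrix.zero_apply]
    refine h α _ _ (by simp [e.injective.ne_iff]) ?_
    rw [he, twoLevelEquiv_inr]; omega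
  · simp only [submatrix_apply, fromBlocks_apply₂₁, Matrix.zero_apply]
    refine h α _ _ (by simp [e.injective.ne_iff]) ?_
    rw [he, twoLevelEquiv_inr]; omega
  · simp only [submatrix_apply, fromBlocks_apply₂₂, Matrix.diagonal_apply]
    split_ifs with hrs
    · rw [hrs]
    · refine h α _ _ (by simpa [e.injective.ne_iff] using hrs) ?_
      rw [he, twoLevelEquiv_inr]; omega

lemma HasTwoLevelForm.exists_unitary (hd : 2 ≤ d) {L : ι → Matrix (Fin d) (Fin d) ℂ}
    (h : HasTwoLevelForm L) : ∃ U ∈ unitaryGroup (Fin d) ℂ,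
      IsTwoLevel fun α => Uᴴ * L α * U := by
  obtain ⟨b, hb⟩ := h
  set e := twoLevelEquiv hd with he
  set B : Matrix (Fin d) (Fin 2 ⊕ Fin (d - 2)) ℂ := Matrix.of fun a k => b k a with hB
  have hBB : Bᴴ * B = 1 := by
    have := toMatrix_orthonormalBasis b 1
    rw [Matrix.mul_one] at this
    rw [← this]
    have h1 : Matrix.toEuclideanLin (1 : Matrix (Fin d) (Fin d) ℂ) = LinearMap.id := by
      ext x; simp
    rw [h1, LinearMap.toMatrix_id]
  have hBe : ∀ A : Matrix (Fin d) (Fin d) ℂ, (B.submatrix id e.symm)ᴴ * A * B.submatrix id e.symm =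
      (Bᴴ * A * B).submatrix e.symm e.symm := by
    intro A
    ext r s
    simp [Matrix.mul_apply]
  refine ⟨B.submatrix id e.symm, ?_, ?_⟩
  · rw [mem_unitaryGroup_iff' (A := B.submatrix id e.symm), star_eq_conjTranspose]
    have := hBe 1
    rw [Matrix.mul_one, Matrix.mul_one, hBB] at this
    rw [this]
    simp
  · intro α i j hij hlt
    obtain ⟨M, D, hMD⟩ := hb α
    rw [toMatrix_orthonormalBasis] at hMD
    simp only [hBe]
    rw [hMD]
    obtain ⟨r, rfl⟩ := e.surjective i
    obtain ⟨s, rfl⟩ := e.surjective j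
    rcases r with r | r <;> rcases s with s | s
    · exfalso
      apply hlt
      rw [he, twoLevelEquiv_inl, twoLevelEquiv_inl]
      omega
    · simp
    · simp
    · simp only [submatrix_apply, Equiv.symm_apply_apply, fromBlocks_apply₂₂]
      exact Matrix.diagonal_apply_ne _ fun hrs => hij (by rw [hrs])

lemma isCompact_unitaryGroup :
    IsCompact {U : Matrix (Fin d) (Fin d) ℂ | U ∈ unitaryGroup (Fin d) ℂ} := by
  have h1 : IsCompact (Set.pi univ fun _ : Fin d => Set.pi univ fun _ : Fin d =>
      Metric.closedBall (0 : ℂ) 1) :=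
    isCompact_univ_pi fun _ => isCompact_univ_pi fun _ => isCompact_closedBall _ _
  refine IsCompact.of_isClosed_subset (X := Matrix (Fin d) (Fin d) ℂ) h1 ?_ ?_
  · simp only [mem_unitaryGroup_iff]
    exact isClosed_eq (continuous_id.mul continuous_id.star) continuous_const
  · intro U hU i _ j _
    simpa using entry_norm_bound_of_unitary hU i j

variable [Fintype ι]

/-- Total rate of the transitions that are absent from the two-level form. -/
noncomputable def offTwoLevelRate (L : ι → Matrix (Fin d) (Fin d) ℂ) : ℝ :=
  ∑ i, ∑ j, if i ≠ j ∧ ¬(i.val < 2 ∧ j.val < 2) then transitionRate L i j else 0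

lemma isTwoLevel_of_offTwoLevelRate_nonpos {L : ι → Matrix (Fin d) (Fin d) ℂ}
    (h : offTwoLevelRate L ≤ 0) : IsTwoLevel L := by
  have hnn : ∀ i j : Fin d,
      0 ≤ if i ≠ j ∧ ¬(i.val < 2 ∧ j.val < 2) then transitionRate L i j else 0 := by
    intro i j
    split_ifs
    · exact transitionRate_nonneg L i j
    · exact le_rfl
  have h0 : offTwoLevelRate L = 0 :=
    le_antisymm h (Finset.sum_nonneg fun i _ => Finset.sum_nonneg fun j _ => hnn i j)
  intro α i j hij hlt
  have h1 := (Finset.sum_eq_zero_iff_of_nonneg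
    fun i _ => Finset.sum_nonneg fun j _ => hnn i j).1 h0 i (Finset.mem_univ _)
  have h2 := (Finset.sum_eq_zero_iff_of_nonneg fun j _ => hnn i j).1 h1 j (Finset.mem_univ _)
  rw [if_pos ⟨hij, hlt⟩] at h2
  have h3 := (Finset.sum_eq_zero_iff_of_nonneg fun α _ => Complex.normSq_nonneg _).1 h2 α
    (Finset.mem_univ _)
  exact Complex.normSq_eq_zero.1 h3

/-- The forbidden rate is continuous on the compact unitary group, and a minimum equal to zero would
provide a two-level basis. -/
lemma exists_offTwoLevelRate_bound (hd : 2 ≤ d) {L : ι → Matrix (Fin d) (Fin d) ℂ}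
    (h : ¬HasTwoLevelForm L) : ∃ η > 0, ∀ U ∈ unitaryGroup (Fin d) ℂ,
      η ≤ offTwoLevelRate fun α => Uᴴ * L α * U := by
  have hcont : Continuous fun U : Matrix (Fin d) (Fin d) ℂ =>
      offTwoLevelRate fun α => Uᴴ * L α * U := by
    unfold offTwoLevelRate transitionRate
    refine continuous_finsetSum _ fun i _ => continuous_finsetSum _ fun j _ => ?_
    split_ifs
    · refine continuous_finsetSum _ fun α _ => Complex.continuous_normSq.comp ?_
      have h1 : Continuous fun U : Matrix (Fin d) (Fin d) ℂ => Uᴴ * L α * U :=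
        (continuous_id.matrix_conjTranspose.mul continuous_const).mul continuous_id
      exact h1.matrix_elem i j
    · exact continuous_const
  obtain ⟨V, hV, hmin⟩ := isCompact_unitaryGroup.exists_isMinOn
    ⟨1, (one_mem _ : (1 : Matrix (Fin d) (Fin d) ℂ) ∈ unitaryGroup (Fin d) ℂ)⟩ hcont.continuousOn
  refine ⟨offTwoLevelRate fun α => Vᴴ * L α * V, ?_, fun U hU => hmin hU⟩
  by_contra hle
  exact h (hasTwoLevelForm_of_isTwoLevel hd hV
    (isTwoLevel_of_offTwoLevelRate_nonpos (not_lt.1 hle)))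

end TwoLevel

/-! ### Optimality forces the two-level form. -/

section Necessity

open Set Filter Topology

variable {d : ℕ} {ι : Type*} [Fintype ι]

/-- The Hermitian part of a controlled trajectory with Hermitian initial value is again a
controlled trajectory. -/
lemma exists_hermitian_trajectory {H : Matrix (Fin d) (Fin d) ℂ} (hH : H.IsHermitian)
    {L : ι → Matrix (Fin d) (Fin d) ℂ} {ρ y : Matrix (Fin d) (Fin d) ℂ} (hρ : ρ.IsHermitian)
    (hy : y ∈ reachableSet (lindbladian H L) ρ) :
    ∃ (T : ℝ) (K z : ℝ → Matrix (Fin d) (Fin d) ℂ), 0 ≤ T ∧ (∀ t, (z t).IsHermitian) ∧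
      (∀ t ∈ Icc 0 T, ∀ i j, HasDerivWithinAt (fun s => z s i j)
        ((hamiltonianPart (K t) (z t) + dissipator L (z t)) i j) (Icc 0 T) t) ∧
      z 0 = ρ ∧ z T = (1 / 2 : ℂ) • (y + yᴴ) := by
  obtain ⟨T, K, x, hT, -, hK, hx, hx0, hxT⟩ := hy
  -- The drift Hamiltonian joins the control. Passing to Hermitian parts avoids an appeal to
  -- uniqueness of solutions.
  refine ⟨T, fun t => K t + H, fun t => (1 / 2 : ℂ) • (x t + (x t)ᴴ), hT, fun t => ?_,
    fun t ht i j => ?_, ?_, by simp only [hxT]⟩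
  · rw [Matrix.IsHermitian, conjTranspose_smul, conjTranspose_add, conjTranspose_conjTranspose,
      add_comm]
    simp
  · have e : hamiltonianPart (K t + H) ((1 / 2 : ℂ) • (x t + (x t)ᴴ)) +
        dissipator L ((1 / 2 : ℂ) • (x t + (x t)ᴴ)) = (1 / 2 : ℂ) •
        ((hamiltonianPart (K t) (x t) + lindbladian H L (x t)) +
          (hamiltonianPart (K t) (x t) + lindbladian H L (x t))ᴴ) := by
      simp only [map_smul, map_add, conjTranspose_add, lindbladian_apply,
        hamiltonianPart_conjTranspose (hK t ht).1, hamiltonianPart_conjTranspose hH,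
        dissipator_conjTranspose, hamiltonianPart_add, smul_add]
      abel
    rw [e]
    have h1 := hx t ht i j
    have h2 := (hx t ht j i).star
    simp only [Matrix.smul_apply, Matrix.add_apply, conjTranspose_apply, smul_eq_mul] at h1 h2 ⊢
    exact (h1.add h2).const_mul (1 / 2 : ℂ)
  · change (1 / 2 : ℂ) • (x 0 + (x 0)ᴴ) = ρ
    rw [hx0, hρ.eq, ← two_smul ℂ, smul_smul]
    norm_num

/-- A forbidden transition between `i` and `j` crosses the cut at `max i j`, which is at least `2`.
The cut at `1` is left out, as it is the one that allowed transitions cross. -/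
lemma offTwoLevelRate_le_sum_cuts (L : ι → Matrix (Fin d) (Fin d) ℂ) :
    offTwoLevelRate L ≤ ∑ k ∈ Finset.Ico 2 d, ∑ i : Fin d, ∑ j : Fin d,
        (if (i.val < k) ↔ (j.val < k) then 0 else transitionRate L i j) := by
  rw [Finset.sum_comm, offTwoLevelRate]
  refine Finset.sum_le_sum fun i _ => ?_
  rw [Finset.sum_comm]
  refine Finset.sum_le_sum fun j _ => ?_
  have hnn : ∀ k ∈ Finset.Ico 2 d,
      0 ≤ if (i.val < k) ↔ (j.val < k) then 0 else transitionRate L i j := by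
    intro k _
    split_ifs
    · exact le_rfl
    · exact transitionRate_nonneg L i j
  split_ifs with hij
  · obtain ⟨hne, hlt⟩ := hij
    have hne' : i.val ≠ j.val := fun h => hne (Fin.ext h)
    have hi := i.isLt
    have hj := j.isLt
    have hk : max i.val j.val ∈ Finset.Ico 2 d := by
      rw [Finset.mem_Ico]; omega
    refine le_trans (le_of_eq ?_) (Finset.single_le_sum hnn hk)
    rw [if_neg]
    omega
  · exact Finset.sum_nonneg hnn

lemma sum_lt_succ (v : Fin d → ℝ) {k : ℕ} (hk : k < d) :
    ∑ i : Fin d with i.val < k + 1, v i = ∑ i : Fin d with i.val < k, v i + v ⟨k, hk⟩ := by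
  have : (Finset.univ.filter fun i : Fin d => i.val < k + 1) =
      insert ⟨k, hk⟩ (Finset.univ.filter fun i : Fin d => i.val < k) := by
    ext i
    simp only [Finset.mem_filter, Finset.mem_univ, true_and, Finset.mem_insert, Fin.ext_iff]
    omega
  rw [this, Finset.sum_insert (by simp), add_comm]

/-- The state with diagonal matrix `p`. -/
noncomputable def diagonalState (p : Fin d → ℝ) (hp : ∀ i, 0 ≤ p i) (hsum : ∑ i, p i = 1) :
    QState d where
  mat := diagonal fun i => (p i : ℂ)
  posSemidef := Matrix.posSemidef_diagonal_iff.2 fun i => by exact_mod_cast hp i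
  trace_eq_one := by
    rw [Matrix.trace_diagonal]
    exact_mod_cast hsum

lemma diagonal_eq_conj_one (p : Fin d → ℝ) : (diagonal fun i => (p i : ℂ)) =
    (1 : Matrix (Fin d) (Fin d) ℂ) * diagonal (fun i => (p i : ℂ)) *
      (1 : Matrix (Fin d) (Fin d) ℂ)ᴴ := by simp

lemma diagonalState_majorizes {p q : Fin d → ℝ} (hp : ∀ i, 0 ≤ p i) (hps : ∑ i, p i = 1)
    (hq : ∀ i, 0 ≤ q i) (hqs : ∑ i, q i = 1) (hpa : Antitone p) (hqa : Antitone q)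
    (h : ∀ k : ℕ, ∑ i : Fin d with i.val < k, q i ≤ ∑ i : Fin d with i.val < k, p i) :
    (diagonalState p hp hps).Majorizes (diagonalState q hq hqs) := by
  intro k
  have h1 := (diagonalState p hp hps).posSemidef.isHermitian.sum_eigenvalues₀_eq (one_mem _) hpa
    (diagonal_eq_conj_one p) k
  have h2 := (diagonalState q hq hqs).posSemidef.isHermitian.sum_eigenvalues₀_eq (one_mem _) hqa
    (diagonal_eq_conj_one q) k
  exact (h2.le.trans (h k)).trans h1.ge

/-- A decreasing probability vector with equidistant entries, and the result of equalizing its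
first two entries. -/
lemma exists_spaced_pair (hd : 2 ≤ d) : ∃ (c : ℝ) (p q : Fin d → ℝ), 0 < c ∧ Antitone p ∧
    Antitone q ∧ (∀ i, 0 ≤ p i) ∧ (∀ i, 0 ≤ q i) ∧ ∑ i, p i = 1 ∧ ∑ i, q i = 1 ∧
    (∀ k : ℕ, ∑ i : Fin d with i.val < k, q i ≤ ∑ i : Fin d with i.val < k, p i) ∧
    (∀ k : ℕ, 2 ≤ k → ∑ i : Fin d with i.val < k, q i = ∑ i : Fin d with i.val < k, p i) ∧
    (∀ i j : Fin d, i.val + 1 = j.val → p i - p j = c) ∧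
    ∑ i, q i ^ 2 = ∑ i, p i ^ 2 - c ^ 2 / 2 := by
  set i0 : Fin d := ⟨0, by omega⟩ with hi0
  set i1 : Fin d := ⟨1, by omega⟩ with hi1
  set Z : ℝ := ∑ i : Fin d, ((d : ℝ) - i.val) with hZ
  have hpos : ∀ i : Fin d, (0 : ℝ) < (d : ℝ) - i.val := fun i =>
    sub_pos.2 (by exact_mod_cast i.isLt)
  have hZpos : 0 < Z := Finset.sum_pos (fun i _ => hpos i) ⟨i0, Finset.mem_univ _⟩
  set c := 1 / Z with hc
  have hcpos : 0 < c := by positivity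
  set p : Fin d → ℝ := fun i => ((d : ℝ) - i.val) * c with hp
  -- Neighbouring entries of `p` differ by `c`, so moving `c / 2` from the first to the second
  -- equalizes them.
  set q : Fin d → ℝ := fun i => p i - c / 2 * ((if i = i0 then 1 else 0) - if i = i1 then 1 else 0)
    with hq
  have h01 : i0 ≠ i1 := by simp [hi0, hi1]
  have hpsum : ∑ i, p i = 1 := by
    simp only [hp]
    rw [← Finset.sum_mul, ← hZ, hc]
    field_simp
  have hcut : ∀ k : ℕ, ∑ i : Fin d with i.val < k, q i = ∑ i : Fin d with i.val < k, p i -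
      c / 2 * ((if 0 < k then 1 else 0) - if 1 < k then 1 else 0) := by
    intro k
    simp only [hq]
    rw [Finset.sum_sub_distrib, ← Finset.mul_sum, Finset.sum_sub_distrib]
    simp [Finset.sum_ite_eq', hi0, hi1]
  have hge : ∀ i : Fin d, 2 ≤ i.val → q i = p i := by
    intro i hi
    have h0 : i ≠ i0 := fun h => by rw [h] at hi; simp [hi0] at hi
    have h1 : i ≠ i1 := fun h => by rw [h] at hi; simp [hi1] at hi
    simp [hq, h0, h1]
  have hlt : ∀ i : Fin d, i.val < 2 → q i = ((d : ℝ) - 1 / 2) * c := by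
    intro i hi
    rcases Nat.lt_succ_iff_lt_or_eq.1 hi with h | h
    · have h0 : i = i0 := Fin.ext (by simp [hi0]; omega)
      rw [h0]
      simp only [hq, h01, if_true, if_false]
      simp only [hp, hi0]
      push_cast; ring
    · have h1 : i = i1 := Fin.ext (by simp [hi1]; omega)
      rw [h1]
      simp only [hq, h01.symm, if_true, if_false]
      simp only [hp, hi1]
      push_cast; ring
  have hpa : Antitone p := by
    intro i j hij
    have : (i.val : ℝ) ≤ j.val := by exact_mod_cast hij
    simp only [hp]
    gcongr
  have hd' : (2 : ℝ) ≤ d := by exact_mod_cast hd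
  refine ⟨c, p, q, hcpos, hpa, ?_, fun i => mul_nonneg (hpos i).le hcpos.le, ?_, hpsum, ?_, ?_, ?_,
    ?_, ?_⟩
  · intro i j hij
    have hij' : i.val ≤ j.val := hij
    by_cases hi : i.val < 2
    · by_cases hj : j.val < 2
      · rw [hlt i hi, hlt j hj]
      · rw [hlt i hi, hge j (not_lt.1 hj)]
        have : (2 : ℝ) ≤ j.val := by exact_mod_cast not_lt.1 hj
        simp only [hp]
        gcongr
        linarith
    · rw [hge i (not_lt.1 hi), hge j (by omega)]
      exact hpa hij
  · intro i
    by_cases hi : i.val < 2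
    · rw [hlt i hi]
      have : (0 : ℝ) ≤ (d : ℝ) - 1 / 2 := by linarith
      positivity
    · rw [hge i (not_lt.1 hi)]
      exact mul_nonneg (hpos i).le hcpos.le
  · have := hcut d
    simp only [Fin.is_lt, Finset.filter_true] at this
    rw [this, hpsum, if_pos (by omega), if_pos (by omega)]
    ring
  · intro k
    rw [hcut]
    split_ifs <;> first | omega | linarith
  · intro k hk
    rw [hcut, if_pos (by omega), if_pos (by omega)]
    ring
  · intro i j hij
    simp only [hp]
    rw [← hij]
    push_cast; ring
  · have h1 : ∀ i, q i ^ 2 = p i ^ 2 - c * ((if i = i0 then p i else 0) - if i = i1 then p i else 0)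
        + c ^ 2 / 4 * ((if i = i0 then 1 else 0) + if i = i1 then 1 else 0) := by
      intro i
      by_cases h0 : i = i0
      · simp only [hq, h0, h01, if_true, if_false]; ring
      · by_cases h1 : i = i1
        · simp only [hq, h1, h01.symm, if_true, if_false]; ring
        · simp only [hq, h0, h1, if_false]; ring
    simp only [h1]
    rw [Finset.sum_add_distrib, Finset.sum_sub_distrib, ← Finset.mul_sum, ← Finset.mul_sum,
      Finset.sum_sub_distrib, Finset.sum_add_distrib]
    simp only [Finset.sum_ite_eq', Finset.mem_univ, if_true]
    simp only [hp, hi0, hi1]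
    push_cast; ring

/-- The cut estimate with gap `δ = 0`: partial sums of a sorted spectrum do not grow. -/
lemma exists_cut_neg_sum_nonneg {L : ι → Matrix (Fin d) (Fin d) ℂ} (h : dissipator L 1 = 0)
    {v : Fin d → ℝ} (hv : Antitone v) (k : ℕ) :
    0 ≤ -∑ i : Fin d with i.val < k, (dissipator L (diagonal fun k => (v k : ℂ)) i i).re := by
  obtain ⟨c, hlo, hhi⟩ := hv.exists_cut k
  have := cut_flow_le h (v := v) (k := k) (c := c) (δ := 0) (by simpa using hlo) (by simpa using hhi)
  simpa using this

theorem IsOptimal.hasTwoLevelForm (hd : 2 ≤ d) {H : Matrix (Fin d) (Fin d) ℂ}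
    (hH : H.IsHermitian) {L : ι → Matrix (Fin d) (Fin d) ℂ}
    (hone : dissipator L 1 = 0) (hopt : IsOptimal (lindbladian H L)) : HasTwoLevelForm L := by
  by_contra hno
  obtain ⟨η, hη, hηU⟩ := exists_offTwoLevelRate_bound hd hno
  obtain ⟨c, p, q, hc, hpa, hqa, hp0, hq0, hp1, hq1, hmaj, heq, hgap, hsq⟩ := exists_spaced_pair hd
  set W := ∑ i, ∑ j, transitionRate L i j with hW
  set S := ∑ i, p i ^ 2 with hS
  have hW0 : 0 ≤ W := Finset.sum_nonneg fun i _ => Finset.sum_nonneg fun j _ =>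
    transitionRate_nonneg L i j
  have hS0 : 0 ≤ S := Finset.sum_nonneg fun i _ => sq_nonneg _
  -- Lower bound for the time in which the purity can fall from `S` by `c ^ 2 / 4` at relative rate
  -- at most `4 * W`; the `+ 1` keeps the denominator positive.
  set T₀ := c ^ 2 / (4 * (4 * W * S + 1)) with hT₀
  have hT₀pos : 0 < T₀ := by positivity
  have hdpos : (0 : ℝ) < d := by exact_mod_cast (by omega : 0 < d)
  -- The first bound keeps the gaps at least `c / 2`; the second makes the permitted loss `d * ε`
  -- smaller than the loss `c / 4 * η * T₀` forced by the dissipation.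
  set ε := min (c / 4) (c * η * T₀ / (8 * d)) with hε
  have hεpos : 0 < ε := lt_min (by positivity) (by positivity)
  set ρ := diagonalState p hp0 hp1 with hρ
  set σ := diagonalState q hq0 hq1 with hσ
  have hconv : σ.mat ∈ closure (reachableSet (lindbladian H L) ρ.mat) :=
    hopt ρ σ (diagonalState_majorizes hp0 hp1 hq0 hq1 hpa hqa hmaj)
  set h : Matrix (Fin d) (Fin d) ℂ → Matrix (Fin d) (Fin d) ℂ :=
    fun y => (1 / 2 : ℂ) • (y + yᴴ) with hh
  have hhc : Continuous h :=
    (continuous_id.add continuous_id.matrix_conjTranspose).const_smul (1 / 2 : ℂ)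
  have hhσ : h σ.mat = σ.mat := by
    simp only [hh]
    rw [σ.posSemidef.isHermitian.eq, ← two_smul ℂ, smul_smul]
    norm_num
  have hσmat : σ.mat = diagonal fun i => (q i : ℂ) := rfl
  -- The purity of the target is `S - c ^ 2 / 2`, so a purity below `S - c ^ 2 / 4` is an open
  -- condition near it. Both conditions are put on the Hermitian part.
  have hopen : IsOpen ({y | d * ∑ a, ∑ b, ‖(σ.mat - h y) a b‖ < ε} ∩
      {y | (h y * h y).trace.re < S - c ^ 2 / 4}) := by
    refine IsOpen.inter (isOpen_lt ?_ continuous_const) (isOpen_lt ?_ continuous_const)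
    · refine continuous_const.mul (continuous_finsetSum _ fun a _ =>
        continuous_finsetSum _ fun b _ => ?_)
      exact ((continuous_const.sub hhc).matrix_elem a b).norm
    · exact Complex.continuous_re.comp (hhc.mul hhc).matrix_trace
  obtain ⟨y, ⟨hy1, hy2⟩, hyr⟩ := mem_closure_iff.1 hconv _ hopen (by
    refine ⟨by rw [mem_ofPred_eq, hhσ]; simpa using hεpos, ?_⟩
    rw [mem_ofPred_eq, hhσ, hσmat, diagonal_mul_diagonal, trace_diagonal]
    have : (∑ i, (q i : ℂ) * q i) = ((∑ i, q i ^ 2 : ℝ) : ℂ) := by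
      push_cast
      exact Finset.sum_congr rfl fun i _ => (sq _).symm
    rw [this, Complex.ofReal_re, hsq]
    have : 0 < c ^ 2 := by positivity
    linarith)
  obtain ⟨T, K, z, hT, hzH, hz, hz0, hzT⟩ :=
    exists_hermitian_trajectory hH ρ.posSemidef.isHermitian hyr
  choose U hU v hv hzU _ using fun t => (hzH t).exists_sorted_spectral
  set f : ℕ → ℝ → ℝ := fun k t => ∑ i : Fin d with i.val < k, v t i with hf
  have hρU : ρ.mat = 1 * diagonal (fun i => (p i : ℂ)) * (1 : Matrix (Fin d) (Fin d) ℂ)ᴴ :=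
    diagonal_eq_conj_one p
  have hσU : σ.mat = 1 * diagonal (fun i => (q i : ℂ)) * (1 : Matrix (Fin d) (Fin d) ℂ)ᴴ :=
    diagonal_eq_conj_one q
  have hf0 : ∀ k, f k 0 = ∑ i : Fin d with i.val < k, p i := by
    intro k
    have h1 := sum_sub_sum_le (hU 0) (one_mem _) (v := v 0) hpa k
    have h2 := sum_sub_sum_le (one_mem _) (hU 0) (v := p) (hv 0) k
    rw [← hzU, ← hρU, hz0] at h1 h2
    simp only [sub_self, Matrix.zero_apply, norm_zero, Finset.sum_const_zero, mul_zero] at h1 h2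
    simp only [hf]
    linarith
  have hfT : ∀ k, ∑ i : Fin d with i.val < k, q i - ε ≤ f k T := by
    intro k
    have h1 := sum_sub_sum_le (one_mem _) (hU T) (v := q) (hv T) k
    rw [← hzU, ← hσU, hzT] at h1
    have h2 := h1.trans_lt hy1
    simp only [hf]
    linarith
  have hone' : ∀ t, dissipator (fun α => (U t)ᴴ * L α * U t) 1 = 0 := fun t =>
    dissipator_one_conj hone (hU t)
  have hmono : ∀ k {a b : ℝ}, 0 ≤ a → a ≤ b → b ≤ T → f k b ≤ f k a := by
    intro k a b ha hab hb
    have := sum_eigenvalues_decrease hz hU hv hzU {k} (η := 0) ha hab hb (fun t _ => by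
      rw [Finset.sum_singleton]
      exact exists_cut_neg_sum_nonneg (hone' t) (hv t) k)
    simpa using this
  -- The gap is the second difference `2 f (k + 1) - f k - f (k + 2)`. By monotonicity the outer
  -- sums are at most their initial values, and the middle one, where `k + 1 ≥ 2`, is within `ε` of
  -- its own, so at least `c - 2 * ε` remains.
  have hgap' : ∀ t ∈ Icc 0 T, ∀ k (hk : k + 1 < d), 1 ≤ k →
      c / 2 ≤ v t ⟨k, by omega⟩ - v t ⟨k + 1, hk⟩ := by
    intro t ht k hk hk1
    have e1 := sum_lt_succ (v t) (k := k) (by omega)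
    have e2 := sum_lt_succ (v t) (k := k + 1) hk
    have e3 := sum_lt_succ p (k := k) (by omega)
    have e4 := sum_lt_succ p (k := k + 1) hk
    have b1 := hmono k le_rfl ht.1 ht.2
    have b2 := hmono (k + 1 + 1) le_rfl ht.1 ht.2
    have b3 := hmono (k + 1) ht.1 ht.2 le_rfl
    have b4 := hfT (k + 1)
    rw [heq (k + 1) (by omega)] at b4
    rw [hf0] at b1 b2
    have b5 := hgap ⟨k, by omega⟩ ⟨k + 1, hk⟩ rfl
    have b6 : ε ≤ c / 4 := min_le_left _ _
    simp only [hf] at b1 b2 b3 b4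
    linarith
  -- With thresholds at the midpoints of gaps of size `c / 2`, each cut has `δ = c / 4`.
  have hdrop := sum_eigenvalues_decrease hz hU hv hzU (Finset.Ico 2 d) (η := c / 4 * η)
    le_rfl hT le_rfl (fun t ht => by
      have h1 := hηU (U t) (hU t)
      have h2 := offTwoLevelRate_le_sum_cuts fun α => (U t)ᴴ * L α * U t
      refine (mul_le_mul_of_nonneg_left (h1.trans h2) (by positivity)).trans ?_
      rw [Finset.mul_sum]
      refine Finset.sum_le_sum fun k hk => ?_
      rw [Finset.mem_Ico] at hk
      obtain ⟨m, rfl⟩ : ∃ m, k = m + 1 := ⟨k - 1, by omega⟩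
      have hg := hgap' t (Ioc_subset_Icc_self ht) m hk.2 (by omega)
      refine cut_flow_le (hone' t) (c := (v t ⟨m, by omega⟩ + v t ⟨m + 1, hk.2⟩) / 2)
        (fun j hj => ?_) (fun j hj => ?_)
      · have : v t ⟨m, by omega⟩ ≤ v t j := hv t (Fin.le_def.2 (Nat.lt_succ_iff.1 hj))
        linarith
      · have : v t j ≤ v t ⟨m + 1, hk.2⟩ := hv t (Fin.le_def.2 hj)
        linarith)
  have hloss : ∑ k ∈ Finset.Ico 2 d, f k 0 ≤ ∑ k ∈ Finset.Ico 2 d, f k T + d * ε := by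
    have h1 : ∑ k ∈ Finset.Ico 2 d, f k 0 ≤ ∑ k ∈ Finset.Ico 2 d, (f k T + ε) := by
      refine Finset.sum_le_sum fun k hk => ?_
      have h2 := hfT k
      rw [heq k (Finset.mem_Ico.1 hk).1] at h2
      rw [hf0]
      linarith
    rw [Finset.sum_add_distrib, Finset.sum_const, Nat.card_Ico, nsmul_eq_mul] at h1
    have h3 : ((d - 2 : ℕ) : ℝ) ≤ d := by exact_mod_cast Nat.sub_le d 2
    nlinarith
  have hpur := purity_lower_bound hT hz hU hzU
  have hv0 : ∀ t, (z t * z t).trace.re = ∑ i, v t i ^ 2 := by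
    intro t
    have : (z t * z t).trace = ((∑ i, v t i ^ 2 : ℝ) : ℂ) := by
      rw [hzU]
      simp only [Matrix.mul_assoc, unitary_cancel_left_assoc (hU t)]
      rw [Matrix.trace_mul_comm]
      simp only [Matrix.mul_assoc, unitary_cancel_left (hU t), Matrix.mul_one]
      simp [Matrix.trace, sq]
    rw [this, Complex.ofReal_re]
  have hS' : ∑ i, v 0 i ^ 2 = S := by
    have hρz : z 0 = diagonal fun i => (p i : ℂ) := hz0
    rw [← hv0 0, hρz, diagonal_mul_diagonal, trace_diagonal, Complex.re_sum]
    simp [hS, sq]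
  have hST : ∑ i, v T i ^ 2 < S - c ^ 2 / 4 := by
    rw [← hv0 T, hzT]
    exact hy2
  rw [hS'] at hpur
  have hTT : T₀ ≤ T := by
    rw [hT₀, div_le_iff₀ (by positivity)]
    nlinarith
  have hεle : ε ≤ c * η * T₀ / (8 * d) := min_le_right _ _
  have h3 : d * ε ≤ c * η * T₀ / 8 := by
    calc d * ε ≤ d * (c * η * T₀ / (8 * d)) := by gcongr
      _ = c * η * T₀ / 8 := by field_simp
  have h4 : c / 4 * η * T₀ ≤ c / 4 * η * T := by gcongr
  simp only [hf] at hloss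
  have h5 : 0 < c * η * T₀ := by positivity
  rw [sub_zero] at hdrop
  linarith

end Necessity

/-! ### Short-time existence for linear equations. -/

section LinearODE

open Set Filter Topology Metric NNReal

variable {E : Type*} [NormedAddCommGroup E] [NormedSpace ℝ E] [CompleteSpace E]

/-- The fixed point of the Picard operator is sought among curves inside the ball, so confinement
comes with existence. -/
lemma IsPicardLindelof.exists_solution_mem_closedBall {f : ℝ → E → E} {tmin tmax : ℝ}
    {t₀ : Icc tmin tmax} {x₀ : E} {a L K : ℝ≥0} (hf : IsPicardLindelof f t₀ x₀ a 0 L K) :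
    ∃ α : ℝ → E, α t₀ = x₀ ∧ (∀ t, α t ∈ closedBall x₀ a) ∧
      ∀ t ∈ Icc tmin tmax, HasDerivWithinAt α (f t (α t)) (Icc tmin tmax) t := by
  obtain ⟨α, hα⟩ := ODE.FunSpace.exists_isFixedPt_next hf (mem_closedBall_self le_rfl)
  refine ⟨α.compProj, by rw [ODE.FunSpace.compProj_val, ← hα, ODE.FunSpace.next_apply₀],
    fun t => α.compProj_mem_closedBall hf.mul_max_le, fun t ht ↦ ?_⟩
  apply ODE.hasDerivWithinAt_picard_Icc t₀.2 hf.continuousOn_uncurry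
    α.continuous_compProj.continuousOn (fun _ _ ↦ α.compProj_mem_closedBall hf.mul_max_le)
    x₀ ht |>.congr_of_mem _ ht
  intro t' ht'
  nth_rw 1 [← hα]
  rw [ODE.FunSpace.compProj_of_mem ht', ODE.FunSpace.next_apply]

/-- Linear equations have solutions on short intervals, which stay close to the initial value. -/
lemma exists_linear_solution {A : ℝ → E →L[ℝ] E} {C δ a : ℝ} (hC : 0 ≤ C) (hδ : 0 ≤ δ) (ha : 0 ≤ a)
    (hA : Continuous A) (hAC : ∀ t ∈ Icc 0 δ, ‖A t‖ ≤ C) (y : E) (h : C * (‖y‖ + a) * δ ≤ a) :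
    ∃ x : ℝ → E, x 0 = y ∧ (∀ t, ‖x t - y‖ ≤ a) ∧
      ∀ t ∈ Icc 0 δ, HasDerivWithinAt x (A t (x t)) (Icc 0 δ) t := by
  lift C to ℝ≥0 using hC
  lift a to ℝ≥0 using ha
  have hpl : IsPicardLindelof (fun t x => A t x) (⟨0, le_rfl, hδ⟩ : Icc 0 δ) y a 0
      (C * (‖y‖₊ + a)) C := by
    refine ⟨fun t ht => ?_, fun x _ => ?_, fun t ht x hx => ?_, ?_⟩
    · exact ((A t).lipschitz.weaken (by exact_mod_cast hAC t ht)).lipschitzOnWith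
    · exact (hA.clm_apply continuous_const).continuousOn
    · have h1 : ‖x‖ ≤ ‖y‖ + a := by
        have h2 : ‖x - y‖ ≤ a := by simpa [dist_eq_norm] using hx
        linarith [norm_le_norm_add_norm_sub' x y]
      calc ‖A t x‖ ≤ ‖A t‖ * ‖x‖ := (A t).le_opNorm x
        _ ≤ C * (‖y‖ + a) := by gcongr; exact hAC t ht
        _ = ((C * (‖y‖₊ + a) : ℝ≥0) : ℝ) := by simp
    · simpa [hδ] using h
  obtain ⟨x, hx0, hxb, hx⟩ := hpl.exists_solution_mem_closedBall
  exact ⟨x, hx0, fun t => by simpa [dist_eq_norm] using hxb t, hx⟩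

end LinearODE

/-! ### Ramps and exponential flows of linear equations. -/

section LinearFlow

open Set Filter Topology

variable {E : Type*} [NormedAddCommGroup E] [NormedSpace ℝ E] [FiniteDimensional ℝ E]

/-- Solutions of the linear equation whose generator is moved from `A` to `A + B` in a short
time. -/
lemma exists_ramp_solution (A B : E →ₗ[ℝ] E) (y : E) {ε : ℝ} (hε : 0 < ε) :
    ∃ (δ : ℝ) (x : ℝ → E), 0 < δ ∧ x 0 = y ∧ ‖x δ - y‖ ≤ ε ∧
      ∀ t ∈ Icc 0 δ, HasDerivWithinAt x (A (x t) + (t / δ) • B (x t)) (Icc 0 δ) t := by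
  have := FiniteDimensional.complete ℝ E
  set A' := LinearMap.toContinuousLinearMap A
  set B' := LinearMap.toContinuousLinearMap B
  set C := ‖A'‖ + ‖B'‖ with hC
  have hC0 : 0 ≤ C := by positivity
  -- Within distance `ε` of `y` the speed is at most `C * (‖y‖ + ε)`, so this duration is too short
  -- to leave the ball.
  set δ := ε / (C * (‖y‖ + ε) + 1) with hδ
  have hδpos : 0 < δ := by positivity
  have hCδ : C * (‖y‖ + ε) * δ ≤ ε := by
    rw [hδ, ← mul_div_assoc, div_le_iff₀ (by positivity)]
    nlinarith [mul_nonneg hC0 (add_nonneg (norm_nonneg y) hε.le)]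
  obtain ⟨x, hx0, hxb, hx⟩ := exists_linear_solution (A := fun t => A' + (t / δ) • B')
    hC0 hδpos.le hε.le (by fun_prop) (fun t ht => by
      refine (norm_add_le _ _).trans ?_
      rw [norm_smul, Real.norm_eq_abs, abs_of_nonneg (div_nonneg ht.1 hδpos.le)]
      have := mul_le_of_le_one_left (norm_nonneg B') ((div_le_one hδpos).2 ht.2)
      linarith) y hCδ
  exact ⟨δ, x, hδpos, hx0, hxb δ, hx⟩

/-- The flow of an autonomous linear differential equation. -/
noncomputable def linearFlow (A : E →ₗ[ℝ] E) (t : ℝ) : E →ₗ[ℝ] E :=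
  (NormedSpace.exp (t • LinearMap.toContinuousLinearMap A) : E →L[ℝ] E)

lemma linearFlow_zero (A : E →ₗ[ℝ] E) (y : E) : linearFlow A 0 y = y := by
  simp [linearFlow]

lemma linearFlow_smul (A : E →ₗ[ℝ] E) (s t : ℝ) : linearFlow (s • A) t = linearFlow A (t * s) := by
  simp only [linearFlow, map_smul, smul_smul]

lemma continuous_linearFlow (A : E →ₗ[ℝ] E) (t : ℝ) : Continuous fun y => linearFlow A t y :=
  (linearFlow A t).continuous_of_finiteDimensional

lemma hasDerivAt_linearFlow (A : E →ₗ[ℝ] E) (y : E) (t : ℝ) :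
    HasDerivAt (fun s : ℝ => linearFlow A s y) (A (linearFlow A t y)) t := by
  have := FiniteDimensional.complete ℝ E
  simpa [linearFlow] using (hasDerivAt_exp_smul_const' (LinearMap.toContinuousLinearMap A) t).clm_apply
    (hasDerivAt_const t y)

/-- Solutions of an autonomous linear equation are given by its flow. -/
lemma linearFlow_eq_of_hasDerivAt (A : E →ₗ[ℝ] E) {x : ℝ → E}
    (hx : ∀ t, HasDerivAt x (A (x t)) t) (t : ℝ) : linearFlow A t (x 0) = x t := by
  have := FiniteDimensional.complete ℝ E
  set A' := LinearMap.toContinuousLinearMap A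
  -- Transporting `x s` by the flow for the remaining time `t - s` gives a constant; compare `s = 0`
  -- with `s = t`.
  have h1 : ∀ s, HasDerivAt (fun s : ℝ => NormedSpace.exp ((t - s) • A') (x s)) 0 s := by
    intro s
    have h2 : HasDerivAt (fun s : ℝ => NormedSpace.exp ((t - s) • A'))
        ((-1 : ℝ) • (NormedSpace.exp ((t - s) • A') * A')) s :=
      (hasDerivAt_exp_smul_const A' (t - s)).scomp s ((hasDerivAt_id s).const_sub t)
    have h3 := h2.clm_apply (hx s)
    have e : ((-1 : ℝ) • (NormedSpace.exp ((t - s) • A') * A')) (x s) +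
        NormedSpace.exp ((t - s) • A') (A (x s)) = 0 := by
      simp [A']
    rwa [e] at h3
  have h3 := is_const_of_deriv_eq_zero (fun s => (h1 s).differentiableAt) (fun s => (h1 s).deriv) 0 t
  simpa [linearFlow] using h3

/-- This is the limit of strong short pulses, in which the drift `B` becomes negligible against the
control `A`. -/
lemma tendsto_linearFlow_add_smul (A B : E →ₗ[ℝ] E) (y : E) :
    Tendsto (fun s : ℝ => linearFlow (A + s • B) 1 y) (𝓝[>] 0) (𝓝 (linearFlow A 1 y)) := by
  have := FiniteDimensional.complete ℝ E
  set A' := LinearMap.toContinuousLinearMap A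
  set B' := LinearMap.toContinuousLinearMap B
  have h1 : Continuous fun s : ℝ => A' + s • B' := by fun_prop
  have h2 := (NormedSpace.exp_analytic (𝕂 := ℝ) (A' + (0 : ℝ) • B')).continuousAt
  have h3 : ContinuousAt (fun s : ℝ => NormedSpace.exp (A' + s • B')) 0 :=
    ContinuousAt.comp (f := fun s : ℝ => A' + s • B') h2 h1.continuousAt
  have h4 := (h3.clm_apply (continuousAt_const (y := y))).tendsto.mono_left
    (nhdsWithin_le_nhds (s := Ioi 0))
  simpa [linearFlow, A', B'] using h4

end LinearFlow

/-! ### Operations under which the closure of the reachable set is stable. -/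

section Control

open Set Filter Topology
open scoped Matrix.Norms.L2Operator

variable {d : ℕ}

/-- A control `H` and a corresponding trajectory `x` on `[0, T]`. -/
def IsTrajectory (G : Matrix (Fin d) (Fin d) ℂ →ₗ[ℂ] Matrix (Fin d) (Fin d) ℂ) (T : ℝ)
    (H x : ℝ → Matrix (Fin d) (Fin d) ℂ) : Prop :=
  ContinuousOn H (Icc 0 T) ∧ (∀ t ∈ Icc 0 T, (H t).IsHermitian ∧ (H t).trace = 0) ∧
    ∀ t ∈ Icc 0 T, HasDerivWithinAt x (hamiltonianPart (H t) (x t) + G (x t)) (Icc 0 T) t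

lemma hasDerivWithinAt_matrix {x : ℝ → Matrix (Fin d) (Fin d) ℂ} {v : Matrix (Fin d) (Fin d) ℂ}
    {S : Set ℝ} {t : ℝ} :
    HasDerivWithinAt x v S t ↔ ∀ i j, HasDerivWithinAt (fun s => x s i j) (v i j) S t := by
  constructor
  · intro h i j
    exact ((LinearMap.toContinuousLinearMap (Matrix.entryLinearMap ℝ ℂ i j :
      Matrix (Fin d) (Fin d) ℂ →ₗ[ℝ] ℂ)).hasFDerivAt).comp_hasDerivWithinAt t h
  · intro h
    exact hasDerivWithinAt_linearMap_matrix h LinearMap.id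

lemma mem_reachableSet_iff {G : Matrix (Fin d) (Fin d) ℂ →ₗ[ℂ] Matrix (Fin d) (Fin d) ℂ}
    {ρ y : Matrix (Fin d) (Fin d) ℂ} : y ∈ reachableSet G ρ ↔
      ∃ (T : ℝ) (H x : ℝ → Matrix (Fin d) (Fin d) ℂ), 0 ≤ T ∧ IsTrajectory G T H x ∧
        x 0 = ρ ∧ x T = y := by
  constructor
  · rintro ⟨T, H, x, hT, hH, hH', hx, h0, h1⟩
    exact ⟨T, H, x, hT, ⟨hH, hH', fun t ht => hasDerivWithinAt_matrix.2 (hx t ht)⟩, h0, h1⟩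
  · rintro ⟨T, H, x, hT, ⟨hH, hH', hx⟩, h0, h1⟩
    exact ⟨T, H, x, hT, hH, hH', fun t ht => hasDerivWithinAt_matrix.1 (hx t ht), h0, h1⟩

/-- The controls must agree at the joint, since the concatenated control has to be continuous;
equality of both controls and states also matches the one-sided derivatives. -/
lemma IsTrajectory.append {G : Matrix (Fin d) (Fin d) ℂ →ₗ[ℂ] Matrix (Fin d) (Fin d) ℂ}
    {T₁ T₂ : ℝ} {H₁ x₁ H₂ x₂ : ℝ → Matrix (Fin d) (Fin d) ℂ} (h₁ : IsTrajectory G T₁ H₁ x₁)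
    (h₂ : IsTrajectory G T₂ H₂ x₂) (hT₁ : 0 ≤ T₁) (hT₂ : 0 ≤ T₂) (hH : H₁ T₁ = H₂ 0)
    (hx : x₁ T₁ = x₂ 0) :
    IsTrajectory G (T₁ + T₂) (fun t => if t ≤ T₁ then H₁ t else H₂ (t - T₁))
      (fun t => if t ≤ T₁ then x₁ t else x₂ (t - T₁)) := by
  have hunion : Icc 0 (T₁ + T₂) = Icc 0 T₁ ∪ Icc T₁ (T₁ + T₂) :=
    (Icc_union_Icc_eq_Icc hT₁ (by linarith)).symm
  have hmaps : MapsTo (fun t => t - T₁) (Icc T₁ (T₁ + T₂)) (Icc 0 T₂) := fun t ht =>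
    ⟨by linarith [ht.1], by linarith [ht.2]⟩
  have hHl : ∀ t ∈ Icc 0 T₁, (if t ≤ T₁ then H₁ t else H₂ (t - T₁)) = H₁ t := fun t ht =>
    if_pos ht.2
  have hxl : ∀ t ∈ Icc 0 T₁, (if t ≤ T₁ then x₁ t else x₂ (t - T₁)) = x₁ t := fun t ht =>
    if_pos ht.2
  have hHr : ∀ t ∈ Icc T₁ (T₁ + T₂), (if t ≤ T₁ then H₁ t else H₂ (t - T₁)) = H₂ (t - T₁) := by
    intro t ht
    split_ifs with h
    · rw [le_antisymm h ht.1, hH, sub_self]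
    · rfl
  have hxr : ∀ t ∈ Icc T₁ (T₁ + T₂), (if t ≤ T₁ then x₁ t else x₂ (t - T₁)) = x₂ (t - T₁) := by
    intro t ht
    split_ifs with h
    · rw [le_antisymm h ht.1, hx, sub_self]
    · rfl
  refine ⟨?_, ?_, ?_⟩
  · rw [hunion]
    refine ContinuousOn.union_of_isClosed (h₁.1.congr hHl) ?_ isClosed_Icc isClosed_Icc
    exact (h₂.1.comp (continuous_id.sub continuous_const).continuousOn hmaps).congr hHr
  · intro t ht
    rw [hunion] at ht
    rcases ht with ht | ht
    · simp only [hHl t ht]; exact h₁.2.1 t ht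
    · simp only [hHr t ht]; exact h₂.2.1 _ (hmaps ht)
  · intro t _
    rw [hunion]
    refine HasDerivWithinAt.union ?_ ?_
    · by_cases h : t ∈ Icc 0 T₁
      · simp only [hHl t h, hxl t h]
        exact (h₁.2.2 t h).congr hxl (hxl t h)
      -- Away from this closed piece the derivative within it is a vacuous condition.
      · exact HasFDerivWithinAt.of_notMem_closure (by rwa [isClosed_Icc.closure_eq])
    · by_cases h : t ∈ Icc T₁ (T₁ + T₂)
      · simp only [hHr t h, hxr t h]
        refine HasDerivWithinAt.congr ?_ hxr (hxr t h)
        have h3 := (h₂.2.2 _ (hmaps h)).scomp t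
          (((hasDerivAt_id t).sub_const T₁).hasDerivWithinAt (s := Icc T₁ (T₁ + T₂))) hmaps
        simpa [Function.comp_def] using h3
      · exact HasFDerivWithinAt.of_notMem_closure (by rwa [isClosed_Icc.closure_eq])

/-- The Hamiltonian superoperator as a linear function of the Hamiltonian. -/
noncomputable def hamiltonianMap : Matrix (Fin d) (Fin d) ℂ →ₗ[ℝ]
    (Matrix (Fin d) (Fin d) ℂ →ₗ[ℝ] Matrix (Fin d) (Fin d) ℂ) where
  toFun K := (hamiltonianPart K).restrictScalars ℝ
  map_add' K K' := by
    ext1 X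
    exact hamiltonianPart_add K K' X
  map_smul' c K := by
    ext1 X
    exact hamiltonianPart_real_smul c K X

lemma hamiltonianMap_apply (K X : Matrix (Fin d) (Fin d) ℂ) :
    hamiltonianMap K X = hamiltonianPart K X := rfl

/-- The generator of the evolution under a constant control. -/
noncomputable def controlledGenerator
    (G : Matrix (Fin d) (Fin d) ℂ →ₗ[ℂ] Matrix (Fin d) (Fin d) ℂ) (K : Matrix (Fin d) (Fin d) ℂ) :
    Matrix (Fin d) (Fin d) ℂ →ₗ[ℝ] Matrix (Fin d) (Fin d) ℂ :=
  hamiltonianMap K + G.restrictScalars ℝ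

lemma controlledGenerator_apply
    (G : Matrix (Fin d) (Fin d) ℂ →ₗ[ℂ] Matrix (Fin d) (Fin d) ℂ)
    (K X : Matrix (Fin d) (Fin d) ℂ) :
    controlledGenerator G K X = hamiltonianPart K X + G X := rfl

/-- The control can be changed continuously to a prescribed value with an arbitrarily small
effect on the state. -/
lemma exists_ramp (G : Matrix (Fin d) (Fin d) ℂ →ₗ[ℂ] Matrix (Fin d) (Fin d) ℂ)
    {K₀ K₁ : Matrix (Fin d) (Fin d) ℂ} (h₀ : K₀.IsHermitian ∧ K₀.trace = 0)
    (h₁ : K₁.IsHermitian ∧ K₁.trace = 0) (y : Matrix (Fin d) (Fin d) ℂ) {ε : ℝ} (hε : 0 < ε) :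
    ∃ (δ : ℝ) (H x : ℝ → Matrix (Fin d) (Fin d) ℂ), 0 < δ ∧ IsTrajectory G δ H x ∧ H 0 = K₀ ∧
      H δ = K₁ ∧ x 0 = y ∧ ‖x δ - y‖ ≤ ε := by
  obtain ⟨δ, x, hδ, hx0, hxδ, hx⟩ :=
    exists_ramp_solution (controlledGenerator G K₀) (hamiltonianMap (K₁ - K₀)) y hε
  refine ⟨δ, fun t => K₀ + (t / δ) • (K₁ - K₀), x, hδ,
    ⟨?_, fun t _ => ⟨?_, ?_⟩, fun t ht => ?_⟩, by simp, by simp [div_self hδ.ne'], hx0, hxδ⟩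
  · exact (continuous_const.add
      ((continuous_id.div_const δ).smul continuous_const)).continuousOn
  · have hs : ((t / δ) • (K₁ - K₀)).IsHermitian := by
      rw [Matrix.IsHermitian, conjTranspose_smul, (h₁.1.sub h₀.1).eq]
      simp
    exact h₀.1.add hs
  · simp [Matrix.trace_add, Matrix.trace_smul, Matrix.trace_sub, h₀.2, h₁.2]
  · have h1 := hx t ht
    rw [controlledGenerator_apply, hamiltonianMap_apply] at h1
    rw [hamiltonianPart_add, hamiltonianPart_real_smul, add_right_comm]
    exact h1

lemma isTrajectory_const (G : Matrix (Fin d) (Fin d) ℂ →ₗ[ℂ] Matrix (Fin d) (Fin d) ℂ)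
    {K : Matrix (Fin d) (Fin d) ℂ} (hK : K.IsHermitian ∧ K.trace = 0) (T : ℝ)
    (y : Matrix (Fin d) (Fin d) ℂ) :
    IsTrajectory G T (fun _ => K) (fun t => linearFlow (controlledGenerator G K) t y) :=
  ⟨continuousOn_const, fun _ _ => hK, fun t _ =>
    (hasDerivAt_linearFlow (controlledGenerator G K) y t).hasDerivWithinAt⟩

/-- A reachable state can be perturbed slightly in such a way that any constant control can be
applied afterwards. -/
lemma exists_flow_mem_reachableSet
    {G : Matrix (Fin d) (Fin d) ℂ →ₗ[ℂ] Matrix (Fin d) (Fin d) ℂ} {ρ y K : Matrix (Fin d) (Fin d) ℂ}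
    (hK : K.IsHermitian ∧ K.trace = 0) {s : ℝ} (hs : 0 < s) (hy : y ∈ reachableSet G ρ)
    {ε : ℝ} (hε : 0 < ε) : ∃ y', ‖y' - y‖ ≤ ε ∧
      linearFlow (controlledGenerator G K) s y' ∈ reachableSet G ρ := by
  obtain ⟨T, H, x, hT, htr, hx0, hxT⟩ := mem_reachableSet_iff.1 hy
  obtain ⟨δ, H', x', hδ, htr', hH0, hHδ, hx0', hxδ⟩ :=
    exists_ramp G (htr.2.1 T ⟨hT, le_rfl⟩) hK y hε
  refine ⟨x' δ, hxδ, mem_reachableSet_iff.2 ?_⟩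
  have h1 := htr.append htr' hT hδ.le hH0.symm (by rw [hxT, hx0'])
  have hTδ : ¬T + δ ≤ T := by linarith
  have h2 := h1.append (isTrajectory_const G hK s (x' δ)) (by positivity) hs.le
    (by simp [hTδ, hHδ]) (by simp [hTδ, linearFlow_zero])
  have h3 : (0 : ℝ) ≤ T + δ := by positivity
  have h4 : ¬T + δ + s ≤ T + δ := by linarith
  refine ⟨_, _, _, by positivity, h2, ?_, ?_⟩
  · simp only [h3, hT, if_true, hx0]
  · simp only [h4, if_false, add_sub_cancel_left]

/-- The ramp to the control `K` costs an arbitrarily small error, and continuity of the flow lets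
the closure absorb it. -/
lemma flow_mem_closure_of_trace_eq_zero
    {G : Matrix (Fin d) (Fin d) ℂ →ₗ[ℂ] Matrix (Fin d) (Fin d) ℂ} {ρ y K : Matrix (Fin d) (Fin d) ℂ}
    (hK : K.IsHermitian ∧ K.trace = 0) {s : ℝ} (hs : 0 < s)
    (hy : y ∈ closure (reachableSet G ρ)) :
    linearFlow (controlledGenerator G K) s y ∈ closure (reachableSet G ρ) := by
  have hcont : Continuous fun X : Matrix (Fin d) (Fin d) ℂ =>
      linearFlow (controlledGenerator G K) s X := continuous_linearFlow _ _
  have key : MapsTo (fun X => linearFlow (controlledGenerator G K) s X) (reachableSet G ρ)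
      (closure (reachableSet G ρ)) := by
    intro y hy
    refine Metric.mem_closure_iff.2 fun ε hε => ?_
    obtain ⟨δ, hδ, hball⟩ := Metric.continuousAt_iff.1 (hcont.continuousAt (x := y)) ε hε
    obtain ⟨y', hy', hmem⟩ := exists_flow_mem_reachableSet hK hs hy (half_pos hδ)
    refine ⟨_, hmem, ?_⟩
    rw [dist_comm]
    exact hball (by rw [dist_eq_norm]; linarith)
  have := map_mem_closure hcont hy key
  rwa [closure_closure] at this

/-- The trace part of `K` is scalar and drops out of the commutator, so tracelessness of controls is
no restriction. -/
lemma flow_mem_closure {G : Matrix (Fin d) (Fin d) ℂ →ₗ[ℂ] Matrix (Fin d) (Fin d) ℂ}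
    {ρ y K : Matrix (Fin d) (Fin d) ℂ} (hK : K.IsHermitian) {s : ℝ} (hs : 0 < s)
    (hy : y ∈ closure (reachableSet G ρ)) :
    linearFlow (controlledGenerator G K) s y ∈ closure (reachableSet G ρ) := by
  set c : ℂ := K.trace / d with hc
  have hK' : (K - c • (1 : Matrix (Fin d) (Fin d) ℂ)).IsHermitian := by
    refine hK.sub ?_
    have htr : star K.trace = K.trace := by rw [← Matrix.trace_conjTranspose, hK.eq]
    have hcc : star c = c := by rw [hc, star_div₀, htr]; simp
    rw [Matrix.IsHermitian, conjTranspose_smul, hcc, conjTranspose_one]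
  have htr : (K - c • (1 : Matrix (Fin d) (Fin d) ℂ)).trace = 0 := by
    -- For `d = 0` the quotient defining `c` has the default value `0`, and traces of empty matrices
    -- vanish.
    rcases Nat.eq_zero_or_pos d with rfl | hd
    · simp [Matrix.trace]
    · have : (d : ℂ) ≠ 0 := by exact_mod_cast hd.ne'
      simp [Matrix.trace_sub, Matrix.trace_smul, hc, this]
  have hgen : controlledGenerator G (K - c • (1 : Matrix (Fin d) (Fin d) ℂ)) =
      controlledGenerator G K := by
    refine LinearMap.ext fun X => ?_
    rw [controlledGenerator_apply, controlledGenerator_apply]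
    have := hamiltonianPart_add (K - c • (1 : Matrix (Fin d) (Fin d) ℂ)) (c • 1) X
    rw [sub_add_cancel, hamiltonianPart_scalar, add_zero] at this
    rw [this]
  have := flow_mem_closure_of_trace_eq_zero (G := G) ⟨hK', htr⟩ hs hy
  rwa [hgen] at this

/-- The control `s⁻¹ • K` applied for time `s` has total generator `K` plus `s` times the drift; let
`s` tend to `0`. -/
lemma hamiltonianFlow_mem_closure
    {G : Matrix (Fin d) (Fin d) ℂ →ₗ[ℂ] Matrix (Fin d) (Fin d) ℂ} {ρ y K : Matrix (Fin d) (Fin d) ℂ}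
    (hK : K.IsHermitian) (hy : y ∈ closure (reachableSet G ρ)) :
    linearFlow (hamiltonianMap K) 1 y ∈ closure (reachableSet G ρ) := by
  refine isClosed_closure.mem_of_tendsto
    (tendsto_linearFlow_add_smul (hamiltonianMap K) (G.restrictScalars ℝ) y) ?_
  filter_upwards [self_mem_nhdsWithin] with s hs
  have hs' : (0 : ℝ) < s := hs
  have hKs : (s⁻¹ • K).IsHermitian := by
    rw [Matrix.IsHermitian, conjTranspose_smul, hK.eq]
    simp
  have h1 := flow_mem_closure (G := G) hKs hs' hy
  have h2 : hamiltonianMap K + s • G.restrictScalars ℝ =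
      s • controlledGenerator G (s⁻¹ • K) := by
    rw [controlledGenerator, map_smul, smul_add, smul_smul, mul_inv_cancel₀ hs'.ne', one_smul]
  rwa [h2, linearFlow_smul, one_mul]

-- `K` is the argument function applied to `U`. Its discontinuity is harmless, because the spectrum
-- is finite.
open Complex in
lemma exists_exp_eq_of_mem_unitaryGroup {U : Matrix (Fin d) (Fin d) ℂ}
    (hU : U ∈ unitaryGroup (Fin d) ℂ) : ∃ K : Matrix (Fin d) (Fin d) ℂ, K.IsHermitian ∧
      NormedSpace.exp (I • K) = U := by
  have hU' : U ∈ unitary (Matrix (Fin d) (Fin d) ℂ) := hU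
  have hn : IsStarNormal U := ⟨by
    rw [commute_iff_eq, Unitary.star_mul_self_of_mem hU', Unitary.mul_star_self_of_mem hU']⟩
  have hc : ContinuousOn arg (spectrum ℂ U) := (Matrix.finite_spectrum U).continuousOn arg
  refine ⟨cfc (arg · : ℂ → ℂ) U, IsSelfAdjoint.cfc_arg U, ?_⟩
  rw [← CFC.exp_eq_normedSpace_exp (𝕜 := ℂ), ← cfc_comp_smul .., ← cfc_comp' ..]
  conv_rhs => rw [← cfc_id' ℂ (U : Matrix (Fin d) (Fin d) ℂ)]
  refine cfc_congr fun y hy ↦ ?_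
  have hy₁ : ‖y‖ = 1 := spectrum.norm_eq_one_of_unitary hU' hy
  have : I * y.arg = log y :=
    Complex.ext (by simp [log_re, spectrum.norm_eq_one_of_unitary hU' hy]) (by simp [log_im])
  simpa [← exp_eq_exp_ℂ, this] using exp_log (by rintro rfl; simp at hy₁)

/-- Conjugation by `exp (t • (Complex.I • K))` solves the equation with Hamiltonian `-K`; the sign
comes from the factor `-i` in front of the commutator. -/
lemma hamiltonianFlow_apply {K : Matrix (Fin d) (Fin d) ℂ} (hK : K.IsHermitian)
    (y : Matrix (Fin d) (Fin d) ℂ) : linearFlow (hamiltonianMap (-K)) 1 y =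
      NormedSpace.exp (Complex.I • K) * y * (NormedSpace.exp (Complex.I • K))ᴴ := by
  set B := Complex.I • K with hB
  set x : ℝ → Matrix (Fin d) (Fin d) ℂ := fun t =>
    NormedSpace.exp (t • B) * y * NormedSpace.exp (t • -B) with hx
  have hd : ∀ t, HasDerivAt x (hamiltonianMap (-K) (x t)) t := by
    intro t
    have h1 := ((hasDerivAt_exp_smul_const' B t).mul_const y).mul
      (hasDerivAt_exp_smul_const (-B) t)
    have e : hamiltonianMap (-K) (x t) = B * NormedSpace.exp (t • B) * y * NormedSpace.exp (t • -B) +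
        NormedSpace.exp (t • B) * y * (NormedSpace.exp (t • -B) * -B) := by
      rw [hamiltonianMap_apply, hamiltonianPart_apply, hB]
      simp only [hx, Matrix.mul_assoc, Matrix.neg_mul, Matrix.mul_neg, Matrix.smul_mul,
        Matrix.mul_smul, hB, smul_neg, neg_smul, sub_neg_eq_add, smul_add, neg_neg]
    rw [e]
    exact h1
  have h := linearFlow_eq_of_hasDerivAt (hamiltonianMap (-K)) hd 1
  have hstar : (NormedSpace.exp B)ᴴ = NormedSpace.exp (-B) := by
    rw [← Matrix.exp_conjTranspose, hB, conjTranspose_smul, hK.eq]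
    simp
  rw [hstar]
  simpa [hx] using h

/-- The closure of the reachable set is invariant under unitary conjugations. -/
lemma conj_mem_closure {G : Matrix (Fin d) (Fin d) ℂ →ₗ[ℂ] Matrix (Fin d) (Fin d) ℂ}
    {ρ y U : Matrix (Fin d) (Fin d) ℂ} (hU : U ∈ unitaryGroup (Fin d) ℂ)
    (hy : y ∈ closure (reachableSet G ρ)) : U * y * Uᴴ ∈ closure (reachableSet G ρ) := by
  obtain ⟨K, hK, rfl⟩ := exists_exp_eq_of_mem_unitaryGroup hU
  rw [← hamiltonianFlow_apply hK]
  exact hamiltonianFlow_mem_closure hK.neg hy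

lemma mem_reachableSet_self (G : Matrix (Fin d) (Fin d) ℂ →ₗ[ℂ] Matrix (Fin d) (Fin d) ℂ)
    (ρ : Matrix (Fin d) (Fin d) ℂ) : ρ ∈ reachableSet G ρ :=
  mem_reachableSet_iff.2 ⟨0, fun _ => 0, _, le_rfl,
    isTrajectory_const G ⟨isHermitian_zero, Matrix.trace_zero _ _⟩ 0 ρ, linearFlow_zero _ _,
    linearFlow_zero _ _⟩

end Control

/-! ### Majorization through T-transforms. -/

section Majorization

variable {d : ℕ}

/-- The T-transform averaging a vector with the result of exchanging two of its entries. -/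
def tTransform (i j : Fin d) (s : ℝ) (v : Fin d → ℝ) : Fin d → ℝ :=
  fun k => (1 - s) * v k + s * v (Equiv.swap i j k)

lemma tTransform_left (i j : Fin d) (s : ℝ) (v : Fin d → ℝ) :
    tTransform i j s v i = v i - s * (v i - v j) := by
  simp only [tTransform, Equiv.swap_apply_left]; ring

lemma tTransform_right (i j : Fin d) (s : ℝ) (v : Fin d → ℝ) :
    tTransform i j s v j = v j + s * (v i - v j) := by
  simp only [tTransform, Equiv.swap_apply_right]; ring

lemma tTransform_of_ne {i j k : Fin d} (s : ℝ) (v : Fin d → ℝ) (hi : k ≠ i) (hj : k ≠ j) :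
    tTransform i j s v k = v k := by
  simp only [tTransform, Equiv.swap_apply_of_ne_of_ne hi hj]; ring

/-- If `v` majorizes `w ≠ v`, there is a T-transform that increases the number of entries in which
the two vectors agree and preserves majorization. -/
lemma exists_tTransform {v w : Fin d → ℝ} (hw : Antitone w)
    (hle : ∀ m : ℕ, 0 ≤ ∑ i : Fin d with i.val < m, (v i - w i))
    (hsum : ∑ i, (v i - w i) = 0) (hne : v ≠ w) :
    ∃ (j k : Fin d) (s : ℝ), j ≠ k ∧ 0 ≤ s ∧ s ≤ 1 ∧
      (∀ m : ℕ, 0 ≤ ∑ i : Fin d with i.val < m, (tTransform j k s v i - w i)) ∧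
      ∑ i, (tTransform j k s v i - w i) = 0 ∧
      (Finset.univ.filter fun i => tTransform j k s v i ≠ w i).card <
        (Finset.univ.filter fun i => v i ≠ w i).card := by
  have hex : ∃ k, v k < w k := by
    by_contra! hall
    have h1 := (Finset.sum_eq_zero_iff_of_nonneg fun i _ => sub_nonneg.2 (hall i)).1 hsum
    exact hne (funext fun i => sub_eq_zero.1 (h1 i (Finset.mem_univ i)))
  -- Let `k` be the first deficient entry and, below, `j` the last excessive entry before it.
  -- Strictly between them `v` and `w` agree; only `v ≤ w` is needed.
  obtain ⟨k, hk, hkmin⟩ := WellFounded.has_min (wellFounded_lt (α := Fin d)) {k | v k < w k} hex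
  have hk' : v k < w k := hk
  have hPk : w k - v k ≤ ∑ i : Fin d with i.val < k.val, (v i - w i) := by
    have h1 := hle (k.val + 1)
    rw [sum_lt_succ (fun i => v i - w i) k.isLt] at h1
    simp only [Fin.eta] at h1
    linarith
  have hex2 : ∃ j, j < k ∧ w j < v j := by
    by_contra! hall
    have : ∑ i : Fin d with i.val < k.val, (v i - w i) ≤ 0 :=
      Finset.sum_nonpos fun i hi => sub_nonpos.2 (hall i (Finset.mem_filter.1 hi).2)
    linarith
  obtain ⟨j, hj, hjmax⟩ := WellFounded.has_min (wellFounded_gt (α := Fin d))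
    {j | j < k ∧ w j < v j} hex2
  obtain ⟨hjk, hj'⟩ : j < k ∧ w j < v j := hj
  have hjkne : j ≠ k := hjk.ne
  have hbetween : ∀ i : Fin d, j < i → i < k → v i - w i ≤ 0 := by
    intro i hi1 hi2
    by_contra hcon
    exact hjmax i ⟨hi2, by linarith⟩ hi1
  have hwjk : w k ≤ w j := hw hjk.le
  -- The largest transfer from `j` to `k` that overshoots neither target; it makes at least one of
  -- the two entries agree with `w`.
  set δ := min (v j - w j) (w k - v k) with hδ
  have hδ1 : δ ≤ v j - w j := min_le_left _ _
  have hδ2 : δ ≤ w k - v k := min_le_right _ _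
  have hδ0 : 0 < δ := lt_min (by linarith) (by linarith)
  have hgap : 0 < v j - v k := by linarith
  set s := δ / (v j - v k) with hs
  have hsδ : s * (v j - v k) = δ := div_mul_cancel₀ _ hgap.ne'
  have hT : ∀ i, tTransform j k s v i - w i =
      (v i - w i) - δ * ((if i = j then 1 else 0) - if i = k then 1 else 0) := by
    intro i
    by_cases h1 : i = j
    · subst h1
      rw [tTransform_left, hsδ, if_pos rfl, if_neg hjkne]; ring
    · by_cases h2 : i = k
      · subst h2
        rw [tTransform_right, hsδ, if_neg h1, if_pos rfl]; ring
      · rw [tTransform_of_ne s v h1 h2, if_neg h1, if_neg h2]; ring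
  have hTs : ∀ N : Finset (Fin d), ∑ i ∈ N, (tTransform j k s v i - w i) =
      ∑ i ∈ N, (v i - w i) - δ * ((if j ∈ N then 1 else 0) - if k ∈ N then 1 else 0) := by
    intro N
    simp only [hT]
    rw [Finset.sum_sub_distrib (fun i => v i - w i), ← Finset.mul_sum,
      Finset.sum_sub_distrib (fun i => if i = j then (1 : ℝ) else 0)]
    simp only [Finset.sum_ite_eq']
  refine ⟨j, k, s, hjkne, by positivity, (div_le_one hgap).2 (by linarith), fun m => ?_, ?_, ?_⟩
  · rw [hTs]
    simp only [Finset.mem_filter, Finset.mem_univ, true_and]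
    have hm := hle m
    by_cases h1 : j.val < m
    · by_cases h2 : k.val < m
      · simpa [h1, h2] using hm
      -- When the cut separates `j` from `k`, the partial sum of `v - w` is at least the one up to
      -- `k`, since the entries between are nonpositive. That one is at least `w k - v k`, so it can
      -- afford `δ`.
      · have hmono : ∑ i : Fin d with i.val < k.val, (v i - w i) ≤
            ∑ i : Fin d with i.val < m, (v i - w i) := by
          rw [Finset.sum_filter, Finset.sum_filter]
          refine Finset.sum_le_sum fun i _ => ?_
          by_cases h3 : i.val < k.val
          · by_cases h4 : i.val < m
            · simp [h3, h4]
            · simp only [h3, h4, if_true, if_false]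
              exact hbetween i (Fin.lt_def.2 (by omega)) h3
          · have h4 : ¬i.val < m := by omega
            simp [h3, h4]
        simp only [h1, h2, if_true, if_false]
        linarith
    · have h2 : ¬k.val < m := by
        have := Fin.lt_def.1 hjk
        omega
      simpa [h1, h2] using hm
  · rw [hTs, hsum]
    simp
  · refine Finset.card_lt_card (Finset.ssubset_iff_subset_ne.2 ⟨?_, ?_⟩)
    · intro i hi
      rw [Finset.mem_filter] at hi ⊢
      refine ⟨hi.1, fun heq => hi.2 ?_⟩
      have h1 : i ≠ j := fun h => by rw [h] at heq; linarith
      have h2 : i ≠ k := fun h => by rw [h] at heq; linarith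
      rw [tTransform_of_ne s v h1 h2, heq]
    · intro heq
      rcases min_choice (v j - w j) (w k - v k) with h | h
      · have hmem : j ∈ Finset.univ.filter fun i => tTransform j k s v i ≠ w i := by
          rw [heq]; simp [hj'.ne']
        refine (Finset.mem_filter.1 hmem).2 ?_
        rw [tTransform_left, hsδ, hδ, h]; ring
      · have hmem : k ∈ Finset.univ.filter fun i => tTransform j k s v i ≠ w i := by
          rw [heq]; simp [hk'.ne]
        refine (Finset.mem_filter.1 hmem).2 ?_
        rw [tTransform_right, hsδ, hδ, h]; ring

/-- A set closed under T-transforms contains every vector majorized by one of its elements. -/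
lemma mem_of_majorizes {S : Set (Fin d → ℝ)}
    (hS : ∀ v ∈ S, ∀ i j : Fin d, i ≠ j → ∀ s : ℝ, 0 ≤ s → s ≤ 1 → tTransform i j s v ∈ S)
    {w : Fin d → ℝ} (hw : Antitone w) :
    ∀ (n : ℕ) (v : Fin d → ℝ), v ∈ S → (Finset.univ.filter fun i => v i ≠ w i).card ≤ n →
      (∀ m : ℕ, 0 ≤ ∑ i : Fin d with i.val < m, (v i - w i)) → ∑ i, (v i - w i) = 0 → w ∈ S := by
  intro n
  induction n with
  | zero =>
    intro v hv hcard _ _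
    have h1 := Finset.card_eq_zero.1 (Nat.le_zero.1 hcard)
    have h2 : v = w := by
      funext i
      by_contra hi
      have : i ∈ Finset.univ.filter fun i => v i ≠ w i := by simp [hi]
      rw [h1] at this
      simp at this
    exact h2 ▸ hv
  | succ n ih =>
    intro v hv hcard hle hsum
    by_cases hne : v = w
    · exact hne ▸ hv
    · obtain ⟨j, k, s, hjk, hs0, hs1, hle', hsum', hlt⟩ := exists_tTransform hw hle hsum hne
      exact ih _ (hS v hv j k hjk s hs0 hs1) (by omega) hle' hsum'

end Majorization

/-! ### Permutations of the basis. -/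

section Permutations

variable {d : ℕ}

/-- The unitary matrix permuting the standard basis. -/
def permutationUnitary (σ : Equiv.Perm (Fin d)) : Matrix (Fin d) (Fin d) ℂ :=
  (1 : Matrix (Fin d) (Fin d) ℂ).submatrix id σ

lemma permutationUnitary_conj (σ : Equiv.Perm (Fin d)) (X : Matrix (Fin d) (Fin d) ℂ) :
    (permutationUnitary σ)ᴴ * X * permutationUnitary σ = X.submatrix σ σ := by
  ext a b
  simp [permutationUnitary, Matrix.mul_apply, Matrix.one_apply]

lemma permutationUnitary_mem (σ : Equiv.Perm (Fin d)) :
    permutationUnitary σ ∈ unitaryGroup (Fin d) ℂ := by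
  rw [mem_unitaryGroup_iff', star_eq_conjTranspose]
  have := permutationUnitary_conj σ 1
  rw [Matrix.mul_one] at this
  rw [this]
  simp

lemma permutationUnitary_conj_diagonal (σ : Equiv.Perm (Fin d)) (v : Fin d → ℂ) :
    (permutationUnitary σ)ᴴ * diagonal v * permutationUnitary σ = diagonal (v ∘ σ) := by
  rw [permutationUnitary_conj, Matrix.submatrix_diagonal_equiv]

lemma exists_perm_apply_pair {a b i j : Fin d} (hab : a ≠ b) (hij : i ≠ j) :
    ∃ σ : Equiv.Perm (Fin d), σ a = i ∧ σ b = j := by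
  have h : i ≠ Equiv.swap a i b := fun h => hab
    ((Equiv.swap a i).injective (by rw [Equiv.swap_apply_left]; exact h))
  refine ⟨(Equiv.swap a i).trans (Equiv.swap (Equiv.swap a i b) j), ?_, ?_⟩
  · rw [Equiv.trans_apply, Equiv.swap_apply_left, Equiv.swap_apply_of_ne_of_ne h hij]
  · rw [Equiv.trans_apply, Equiv.swap_apply_left]

end Permutations

/-! ### Dynamics of diagonal matrices in a two-level basis. -/

section TwoLevelDynamics

open Set Filter Topology

variable {d : ℕ} {ι : Type*} [Fintype ι]

lemma IsTwoLevel.transitionRate_eq_zero {L : ι → Matrix (Fin d) (Fin d) ℂ} (h : IsTwoLevel L)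
    {i j : Fin d} (hij : i ≠ j) (hlt : ¬(i.val < 2 ∧ j.val < 2)) : transitionRate L i j = 0 := by
  rw [transitionRate]
  exact Finset.sum_eq_zero fun α _ => by rw [h α i j hij hlt, map_zero]

lemma eq_of_lt_two {i i₀ i₁ : Fin d} (h0 : i₀.val = 0) (h1 : i₁.val = 1) (h : i.val < 2) :
    i = i₀ ∨ i = i₁ := by
  rcases Nat.lt_succ_iff_lt_or_eq.1 h with h | h
  · exact Or.inl (Fin.ext (by omega))
  · exact Or.inr (Fin.ext (by omega))

/-- The first level exchanges weight only with the second, so the balance of inflow and outflow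
there is symmetry of the rate. -/
lemma IsTwoLevel.transitionRate_comm {L : ι → Matrix (Fin d) (Fin d) ℂ} (h : IsTwoLevel L)
    (hone : dissipator L 1 = 0) {i₀ i₁ : Fin d} (h0 : i₀.val = 0) (h1 : i₁.val = 1) :
    transitionRate L i₁ i₀ = transitionRate L i₀ i₁ := by
  have hne : i₀ ≠ i₁ := fun h => by rw [h] at h0; omega
  have e := transitionRate_sum_eq hone i₀
  have hz : ∀ j, j ≠ i₀ ∧ j ≠ i₁ → ¬(i₀.val < 2 ∧ j.val < 2) := fun j hj hlt =>
    (eq_of_lt_two h0 h1 hlt.2).elim hj.1 hj.2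
  rw [Finset.sum_eq_add i₀ i₁ hne
      (fun j _ hj => h.transitionRate_eq_zero hj.1.symm (hz j hj)) (by simp) (by simp),
    Finset.sum_eq_add i₀ i₁ hne
      (fun j _ hj => h.transitionRate_eq_zero hj.1 fun hlt => hz j hj hlt.symm)
      (by simp) (by simp)] at e
  linarith

lemma IsTwoLevel.dissipator_diag {L : ι → Matrix (Fin d) (Fin d) ℂ} (h : IsTwoLevel L)
    (hone : dissipator L 1 = 0) {i₀ i₁ : Fin d} (h0 : i₀.val = 0) (h1 : i₁.val = 1)
    (v : Fin d → ℝ) (i : Fin d) : dissipator L (diagonal fun k => (v k : ℂ)) i i =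
      ((transitionRate L i₀ i₁ * (v (Equiv.swap i₀ i₁ i) - v i) : ℝ) : ℂ) := by
  have hne : i₀ ≠ i₁ := fun h => by rw [h] at h0; omega
  have hcomm := h.transitionRate_comm hone h0 h1
  rw [dissipator_diagonal_diag]
  congr 1
  have hzero : ∀ j, ¬(i.val < 2 ∧ j.val < 2) →
      transitionRate L i j * v j - transitionRate L j i * v i = 0 := by
    intro j hlt
    by_cases hij : i = j
    · rw [hij, sub_self]
    · rw [h.transitionRate_eq_zero hij hlt,
        h.transitionRate_eq_zero (Ne.symm hij) fun hlt' => hlt hlt'.symm]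
      ring
  by_cases hi : i.val < 2
  · rw [Finset.sum_eq_add i₀ i₁ hne (fun j _ hj => hzero j fun hlt =>
      (eq_of_lt_two h0 h1 hlt.2).elim hj.1 hj.2) (by simp) (by simp)]
    rcases eq_of_lt_two h0 h1 hi with rfl | rfl
    · rw [Equiv.swap_apply_left, hcomm]; ring
    · rw [Equiv.swap_apply_right, hcomm]; ring
  · rw [Finset.sum_eq_zero fun j _ => hzero j fun hlt => hi hlt.1,
      Equiv.swap_apply_of_ne_of_ne (fun h => hi (by omega)) (fun h => hi (by omega))]
    ring

/-- No level `k` is linked to both `i` and `j` by the block structure, so each product in the entry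
has a vanishing factor. -/
lemma IsTwoLevel.dissipator_off {L : ι → Matrix (Fin d) (Fin d) ℂ} (h : IsTwoLevel L)
    (v : Fin d → ℂ) {i j : Fin d} (hij : i ≠ j) (hlt : ¬(i.val < 2 ∧ j.val < 2)) :
    dissipator L (diagonal v) i j = 0 := by
  rw [dissipator_diagonal_apply]
  refine Finset.sum_eq_zero fun α _ => ?_
  have hz : ∀ k : Fin d, (L α i k = 0 ∨ L α j k = 0) ∧ (L α k i = 0 ∨ L α k j = 0) := by
    intro k
    have aux : (i ≠ k ∧ ¬(i.val < 2 ∧ k.val < 2)) ∨ (j ≠ k ∧ ¬(j.val < 2 ∧ k.val < 2)) := by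
      by_cases hik : i = k
      · subst hik
        exact Or.inr ⟨hij.symm, fun hh => hlt hh.symm⟩
      · by_cases hjk : j = k
        · subst hjk
          exact Or.inl ⟨hik, hlt⟩
        · by_cases hi : i.val < 2 ∧ k.val < 2
          · exact Or.inr ⟨hjk, fun hh => hlt ⟨hi.1, hh.1⟩⟩
          · exact Or.inl ⟨hik, hi⟩
    rcases aux with ⟨h1, h2⟩ | ⟨h1, h2⟩
    · exact ⟨Or.inl (h α i k h1 h2), Or.inl (h α k i h1.symm fun hh => h2 hh.symm)⟩
    · exact ⟨Or.inr (h α j k h1 h2), Or.inr (h α k j h1.symm fun hh => h2 hh.symm)⟩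
  rw [Finset.sum_eq_zero fun k _ => ?_, Finset.sum_eq_zero fun k _ => ?_]
  · ring
  · rcases (hz k).2 with h1 | h1 <;> simp [h1]
  · rcases (hz k).1 with h1 | h1 <;> simp [h1]

/-- The entry depends linearly on `v i₀` and `v i₁` and vanishes on the identity, so only the
difference matters. A commutator with a diagonal matrix has the same form, so a Hamiltonian can
cancel it. -/
lemma IsTwoLevel.dissipator_block {L : ι → Matrix (Fin d) (Fin d) ℂ} (h : IsTwoLevel L)
    (hone : dissipator L 1 = 0) {i₀ i₁ : Fin d} (h0 : i₀.val = 0) (h1 : i₁.val = 1) :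
    ∃ z : ℂ, ∀ v : Fin d → ℂ, dissipator L (diagonal v) i₀ i₁ = (v i₀ - v i₁) * z := by
  have hne : i₀ ≠ i₁ := fun h => by rw [h] at h0; omega
  set A := ∑ α, L α i₀ i₀ * star (L α i₁ i₀) with hA
  set B := ∑ α, L α i₀ i₁ * star (L α i₁ i₁) with hB
  set C := ∑ α, ∑ k, star (L α k i₀) * L α k i₁ with hC
  have e : ∀ v : Fin d → ℂ, dissipator L (diagonal v) i₀ i₁ =
      A * v i₀ + B * v i₁ - 1 / 2 * ((v i₀ + v i₁) * C) := by
    intro v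
    rw [dissipator_diagonal_apply, Finset.sum_sub_distrib]
    congr 1
    · rw [hA, hB, Finset.sum_mul, Finset.sum_mul, ← Finset.sum_add_distrib]
      refine Finset.sum_congr rfl fun α _ => ?_
      rw [Finset.sum_eq_add i₀ i₁ hne (fun k _ hk => ?_) (by simp) (by simp)]
      · ring
      · rw [h α i₀ k hk.1.symm fun hlt => (eq_of_lt_two h0 h1 hlt.2).elim hk.1 hk.2]
        ring
    · rw [hC, ← Finset.mul_sum, ← Finset.mul_sum]
  have h2 := e fun _ => 1
  rw [show (diagonal fun _ : Fin d => (1 : ℂ)) = 1 from diagonal_one, hone, Matrix.zero_apply] at h2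
  have h3 : C = A + B := by linear_combination h2
  refine ⟨1 / 2 * (A - B), fun v => ?_⟩
  rw [e, h3]
  ring

/-- In a basis of two-level form, a suitable constant control turns the evolution of diagonal
matrices into an exchange of the first two entries. -/
lemma IsTwoLevel.exists_control {L : ι → Matrix (Fin d) (Fin d) ℂ} (h : IsTwoLevel L)
    (hone : dissipator L 1 = 0) {i₀ i₁ : Fin d} (h0 : i₀.val = 0) (h1 : i₁.val = 1) :
    ∃ K : Matrix (Fin d) (Fin d) ℂ, K.IsHermitian ∧ ∀ v : Fin d → ℝ,
      hamiltonianPart K (diagonal fun k => (v k : ℂ)) + dissipator L (diagonal fun k => (v k : ℂ)) =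
      diagonal fun k => ((transitionRate L i₀ i₁ * (v (Equiv.swap i₀ i₁ k) - v k) : ℝ) : ℂ) := by
  have hne : i₀ ≠ i₁ := fun h => by rw [h] at h0; omega
  obtain ⟨z, hz⟩ := h.dissipator_block hone h0 h1
  -- The entry `Complex.I * z` turns `-i [K, ·]` into `(v i₁ - v i₀) * z`, the negative of the
  -- coherence produced by the dissipator.
  set K : Matrix (Fin d) (Fin d) ℂ :=
    Matrix.single i₀ i₁ (Complex.I * z) + (Matrix.single i₀ i₁ (Complex.I * z))ᴴ with hK
  have hKH : K.IsHermitian := by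
    rw [Matrix.IsHermitian, hK, conjTranspose_add, conjTranspose_conjTranspose, add_comm]
  have hent : ∀ (v : Fin d → ℂ) (i j : Fin d), hamiltonianPart K (diagonal v) i j =
      -Complex.I * (K i j * (v j - v i)) := by
    intro v i j
    rw [hamiltonianPart_apply, Matrix.smul_apply, Matrix.sub_apply, Matrix.mul_diagonal,
      Matrix.diagonal_mul, smul_eq_mul]
    ring
  refine ⟨K, hKH, fun v => ?_⟩
  set X : Matrix (Fin d) (Fin d) ℂ := diagonal fun k => (v k : ℂ) with hX
  have hXH : Xᴴ = X := by
    rw [hX, diagonal_conjTranspose]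
    congr 1
    funext k
    simp
  have h01 : (hamiltonianPart K X + dissipator L X) i₀ i₁ = 0 := by
    have hK01 : K i₀ i₁ = Complex.I * z := by
      simp [hK, hne, hne.symm]
    rw [Matrix.add_apply, hX, hent, hz, hK01]
    linear_combination (v i₁ - v i₀ : ℂ) * z * (-Complex.I_mul_I)
  have hherm : (hamiltonianPart K X + dissipator L X)ᴴ =
      hamiltonianPart K X + dissipator L X := by
    rw [conjTranspose_add, hamiltonianPart_conjTranspose hKH, dissipator_conjTranspose, hXH]
  ext i j
  by_cases hij : i = j
  · subst hij
    rw [Matrix.add_apply, hX, hent, h.dissipator_diag hone h0 h1, diagonal_apply_eq, sub_self]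
    ring
  · rw [diagonal_apply_ne _ hij]
    by_cases hlt : i.val < 2 ∧ j.val < 2
    · rcases eq_of_lt_two h0 h1 hlt.1 with rfl | rfl <;>
        rcases eq_of_lt_two h0 h1 hlt.2 with rfl | rfl
      · exact absurd rfl hij
      · exact h01
      · rw [← hherm, conjTranspose_apply, h01, star_zero]
      · exact absurd rfl hij
    · rw [Matrix.add_apply, hX, hent, h.dissipator_off _ hij hlt]
      have : K i j = 0 := by
        have e1 : ¬(i₀ = i ∧ i₁ = j) := fun hh => hlt (by rw [← hh.1, ← hh.2]; omega)
        have e2 : ¬(i₀ = j ∧ i₁ = i) := fun hh => hlt (by rw [← hh.1, ← hh.2]; omega)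
        rw [hK, Matrix.add_apply, conjTranspose_apply, Matrix.single_apply, Matrix.single_apply,
          if_neg e1, if_neg e2]
        simp
      rw [this]
      ring

end TwoLevelDynamics

/-! ### The two-level form suffices. -/

section Sufficiency

open Set Filter Topology

variable {d : ℕ} {ι : Type*} [Fintype ι]

lemma two_le_of_dissipator_ne_zero {L : ι → Matrix (Fin d) (Fin d) ℂ} (hone : dissipator L 1 = 0)
    (hne : dissipator L ≠ 0) : 2 ≤ d := by
  by_contra hd
  have hsub : Subsingleton (Fin d) := ⟨fun i j => Fin.ext (by omega)⟩
  refine hne (LinearMap.ext fun X => ?_)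
  rcases isEmpty_or_nonempty (Fin d) with hE | ⟨⟨a⟩⟩
  · ext i
    exact hE.elim i
  · have hX : X = X a a • (1 : Matrix (Fin d) (Fin d) ℂ) := by
      ext i j
      rw [Subsingleton.elim i a, Subsingleton.elim j a]
      simp
    rw [hX, map_smul, hone, smul_zero, LinearMap.zero_apply]

lemma dissipator_eq_zero_of_scalar {L : ι → Matrix (Fin d) (Fin d) ℂ}
    (h : ∀ α, ∃ c : ℂ, L α = c • (1 : Matrix (Fin d) (Fin d) ℂ)) : dissipator L = 0 := by
  refine LinearMap.ext fun X => ?_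
  rw [dissipator_apply, LinearMap.zero_apply]
  refine Finset.sum_eq_zero fun α _ => ?_
  obtain ⟨c, hc⟩ := h α
  rw [hc]
  simp only [conjTranspose_smul, conjTranspose_one, Matrix.smul_mul, Matrix.mul_smul,
    Matrix.one_mul, Matrix.mul_one, smul_smul]
  rw [← add_smul, smul_smul, ← sub_smul]
  convert zero_smul ℂ X using 2
  ring

/-- The real reflection mixing the first two basis vectors with coefficients `3/5` and `4/5`. -/
lemma exists_mixing_reflection {i₀ i₁ : Fin d} (hne : i₀ ≠ i₁) :
    ∃ R ∈ unitaryGroup (Fin d) ℂ, ∀ D : Fin d → ℂ,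
      (∀ a b, a ≠ b → ¬((a = i₀ ∨ a = i₁) ∧ (b = i₀ ∨ b = i₁)) →
        (Rᴴ * diagonal D * R) a b = 0) ∧
      (Rᴴ * diagonal D * R) i₀ i₁ = -(168 / 625) * (D i₀ - D i₁) := by
  -- A rational unit vector with unequal components: the reflection orthogonal to it couples the two
  -- levels, whereas equal components would only exchange them up to sign.
  set u : Fin d → ℂ := fun k => (if k = i₀ then 3 / 5 else 0) + if k = i₁ then 4 / 5 else 0 with hu
  set P : Matrix (Fin d) (Fin d) ℂ := vecMulVec u u with hP
  have hu0 : u i₀ = 3 / 5 := by simp [hu, hne]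
  have hu1 : u i₁ = 4 / 5 := by simp [hu, hne.symm]
  have hu' : ∀ k, ¬(k = i₀ ∨ k = i₁) → u k = 0 := by
    intro k hk
    rw [not_or] at hk
    simp [hu, hk.1, hk.2]
  have husum : ∀ D : Fin d → ℂ, ∑ k, u k * D k * u k = 9 / 25 * D i₀ + 16 / 25 * D i₁ := by
    intro D
    rw [Finset.sum_eq_add i₀ i₁ hne (fun k _ hk => ?_) (by simp) (by simp)]
    · rw [hu0, hu1]; ring
    · rw [hu' k (by rw [not_or]; exact hk)]; ring
  have hPDP : ∀ D : Fin d → ℂ, P * diagonal D * P = (9 / 25 * D i₀ + 16 / 25 * D i₁) • P := by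
    intro D
    ext a b
    rw [Matrix.mul_apply, Matrix.smul_apply, smul_eq_mul, ← husum D, Finset.sum_mul]
    refine Finset.sum_congr rfl fun k _ => ?_
    rw [Matrix.mul_diagonal]
    simp only [hP, vecMulVec_apply]
    ring
  have hPH : Pᴴ = P := by
    ext a b
    have : ∀ k, star (u k) = u k := by
      intro k
      simp only [hu, star_add]
      split_ifs <;> simp
    rw [conjTranspose_apply, hP, vecMulVec_apply, vecMulVec_apply, star_mul', this, this, mul_comm]
  have hPP : P * P = P := by
    have := hPDP fun _ => 1
    rw [diagonal_one, Matrix.mul_one] at this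
    rw [this]
    norm_num
  have hRH : (1 - (2 : ℂ) • P)ᴴ = 1 - (2 : ℂ) • P := by
    rw [conjTranspose_sub, conjTranspose_smul, hPH, conjTranspose_one]
    simp
  have hRDR : ∀ D : Fin d → ℂ, (1 - (2 : ℂ) • P)ᴴ * diagonal D * (1 - (2 : ℂ) • P) =
      diagonal D - (2 : ℂ) • (P * diagonal D) - (2 : ℂ) • (diagonal D * P) +
        (4 * (9 / 25 * D i₀ + 16 / 25 * D i₁)) • P := by
    intro D
    rw [hRH, mul_smul, ← hPDP]
    simp only [Matrix.sub_mul, Matrix.mul_sub, Matrix.one_mul, Matrix.mul_one, Matrix.smul_mul,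
      Matrix.mul_smul, smul_sub, smul_smul]
    norm_num
    abel
  have hent : ∀ (D : Fin d → ℂ) (a b : Fin d), a ≠ b →
      ((1 - (2 : ℂ) • P)ᴴ * diagonal D * (1 - (2 : ℂ) • P) : Matrix (Fin d) (Fin d) ℂ) a b =
      u a * u b * (4 * (9 / 25 * D i₀ + 16 / 25 * D i₁) - 2 * D a - 2 * D b) := by
    intro D a b hab
    rw [hRDR, Matrix.add_apply, Matrix.sub_apply, Matrix.sub_apply, diagonal_apply_ne _ hab,
      Matrix.smul_apply, Matrix.smul_apply, Matrix.smul_apply, Matrix.mul_diagonal,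
      Matrix.diagonal_mul, hP, vecMulVec_apply, smul_eq_mul, smul_eq_mul, smul_eq_mul]
    ring
  refine ⟨1 - (2 : ℂ) • P, ?_, fun D => ⟨fun a b hab hn => ?_, ?_⟩⟩
  · rw [mem_unitaryGroup_iff', star_eq_conjTranspose]
    have := hRDR fun _ => 1
    rw [diagonal_one, Matrix.mul_one] at this
    rw [this, Matrix.mul_one, Matrix.one_mul, sub_sub, ← add_smul, sub_add, ← sub_smul]
    norm_num
  · rw [hent D a b hab]
    by_cases ha : a = i₀ ∨ a = i₁
    · rw [hu' b fun hb => hn ⟨ha, hb⟩]; ring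
    · rw [hu' a ha]; ring
  · rw [hent D i₀ i₁ hne, hu0, hu1]
    ring

/-- A nontrivial unital dissipator of two-level form has a two-level form in which the first two
levels exchange weight. -/
lemma HasTwoLevelForm.exists_positive_rate {L : ι → Matrix (Fin d) (Fin d) ℂ} (hd : 2 ≤ d)
    (h : HasTwoLevelForm L) (hone : dissipator L 1 = 0) (hne : dissipator L ≠ 0)
    {i₀ i₁ : Fin d} (h0 : i₀.val = 0) (h1 : i₁.val = 1) :
    ∃ V ∈ unitaryGroup (Fin d) ℂ, (IsTwoLevel fun α => Vᴴ * L α * V) ∧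
      0 < transitionRate (fun α => Vᴴ * L α * V) i₀ i₁ := by
  have h01 : i₀ ≠ i₁ := fun h => by rw [h] at h0; omega
  obtain ⟨V, hV, hVL⟩ := h.exists_unitary hd
  rcases (transitionRate_nonneg (fun α => Vᴴ * L α * V) i₀ i₁).lt_or_eq with hpos | hzero
  · exact ⟨V, hV, hVL, hpos⟩
  -- With zero exchange rate all `L α` are diagonal in the basis `V`. The idea is to bring two
  -- levels on which some `L β` differs into the first two places and mix them.
  have hrate : ∀ i j : Fin d, transitionRate (fun α => Vᴴ * L α * V) i j = 0 →
      ∀ α, (Vᴴ * L α * V) i j = 0 := fun i j hij α => Complex.normSq_eq_zero.1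
    ((Finset.sum_eq_zero_iff_of_nonneg fun α _ => Complex.normSq_nonneg _).1 hij α
      (Finset.mem_univ _))
  have hdiag : ∀ α, Vᴴ * L α * V = diagonal fun k => (Vᴴ * L α * V) k k := by
    intro α
    ext i j
    by_cases hij : i = j
    · subst hij; rw [diagonal_apply_eq]
    · rw [diagonal_apply_ne _ hij]
      by_cases hlt : i.val < 2 ∧ j.val < 2
      · rcases eq_of_lt_two h0 h1 hlt.1 with rfl | rfl <;>
          rcases eq_of_lt_two h0 h1 hlt.2 with rfl | rfl
        · exact absurd rfl hij
        · exact hrate _ _ hzero.symm α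
        · refine hrate _ _ ?_ α
          rw [hVL.transitionRate_comm (dissipator_one_conj hone hV) h0 h1, ← hzero]
        · exact absurd rfl hij
      · exact hVL α i j hij hlt
  -- Otherwise every `L α` would be scalar and the dissipator would vanish.
  obtain ⟨β, i, j, hij⟩ : ∃ α, ∃ i j, (Vᴴ * L α * V) i i ≠ (Vᴴ * L α * V) j j := by
    by_contra! hall
    refine hne (dissipator_eq_zero_of_scalar fun α => ⟨(Vᴴ * L α * V) i₀ i₀, ?_⟩)
    have e1 : Vᴴ * L α * V = (Vᴴ * L α * V) i₀ i₀ • (1 : Matrix (Fin d) (Fin d) ℂ) := by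
      rw [hdiag α, smul_one_eq_diagonal, diagonal_apply_eq]
      congr 1
      funext k
      exact hall α k i₀
    have e2 : V * (Vᴴ * L α * V) * Vᴴ = L α := by
      simp only [Matrix.mul_assoc, unitary_cancel_right hV, Matrix.mul_one,
        unitary_cancel_right_assoc hV]
    rw [e1] at e2
    simpa [unitary_cancel_right hV] using e2.symm
  obtain ⟨σ, hσ0, hσ1⟩ := exists_perm_apply_pair h01 (show i ≠ j from fun h => hij (by rw [h]))
  obtain ⟨R, hR, hRD⟩ := exists_mixing_reflection h01
  set Q := permutationUnitary σ with hQ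
  have hW : ∀ α, (V * Q * R)ᴴ * L α * (V * Q * R) =
      Rᴴ * diagonal ((fun k => (Vᴴ * L α * V) k k) ∘ σ) * R := by
    intro α
    rw [← permutationUnitary_conj_diagonal, ← hdiag]
    simp only [conjTranspose_mul, Matrix.mul_assoc, hQ]
  refine ⟨V * Q * R, mul_mem (mul_mem hV (permutationUnitary_mem σ)) hR, fun α a b hab hlt => ?_, ?_⟩
  · change ((V * Q * R)ᴴ * L α * (V * Q * R)) a b = 0
    rw [hW]
    refine (hRD _).1 a b hab fun hh => hlt ?_
    rcases hh with ⟨rfl | rfl, rfl | rfl⟩ <;> constructor <;> omega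
  · refine Finset.sum_pos' (fun α _ => Complex.normSq_nonneg _) ⟨β, Finset.mem_univ _, ?_⟩
    change 0 < Complex.normSq (((V * Q * R)ᴴ * L β * (V * Q * R)) i₀ i₁)
    rw [hW, Complex.normSq_pos, (hRD _).2]
    simp only [Function.comp_apply, hσ0, hσ1]
    exact mul_ne_zero (by norm_num) (sub_ne_zero.2 hij)

/-- The vectors which, in the basis given by `V`, are the diagonals of diagonal matrices that can
be approximated from `ρ`. -/
def reachableDiagonals (G : Matrix (Fin d) (Fin d) ℂ →ₗ[ℂ] Matrix (Fin d) (Fin d) ℂ)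
    (ρ V : Matrix (Fin d) (Fin d) ℂ) : Set (Fin d → ℝ) :=
  {v | V * diagonal (fun k => (v k : ℂ)) * Vᴴ ∈ closure (reachableSet G ρ)}

lemma isClosed_reachableDiagonals (G : Matrix (Fin d) (Fin d) ℂ →ₗ[ℂ] Matrix (Fin d) (Fin d) ℂ)
    (ρ V : Matrix (Fin d) (Fin d) ℂ) : IsClosed (reachableDiagonals G ρ V) := by
  refine isClosed_closure.preimage ?_
  have h1 : Continuous fun v : Fin d → ℝ => (diagonal fun k => (v k : ℂ)) :=
    Continuous.matrix_diagonal
      (continuous_pi fun k => Complex.continuous_ofReal.comp (continuous_apply k))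
  exact (continuous_const.mul h1).mul continuous_const

lemma comp_perm_mem_reachableDiagonals
    {G : Matrix (Fin d) (Fin d) ℂ →ₗ[ℂ] Matrix (Fin d) (Fin d) ℂ}
    {ρ V : Matrix (Fin d) (Fin d) ℂ} (hV : V ∈ unitaryGroup (Fin d) ℂ) (σ : Equiv.Perm (Fin d))
    {v : Fin d → ℝ} (hv : v ∈ reachableDiagonals G ρ V) : v ∘ σ ∈ reachableDiagonals G ρ V := by
  have hU : V * (permutationUnitary σ)ᴴ * Vᴴ ∈ unitaryGroup (Fin d) ℂ :=
    mul_mem (mul_mem hV (conjTranspose_mem_unitary (permutationUnitary_mem σ)))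
      (conjTranspose_mem_unitary hV)
  have h1 := conj_mem_closure hU hv
  have h2 := permutationUnitary_conj_diagonal σ fun k => (v k : ℂ)
  have h3 : V * (permutationUnitary σ)ᴴ * Vᴴ * (V * diagonal (fun k => (v k : ℂ)) * Vᴴ) *
      (V * (permutationUnitary σ)ᴴ * Vᴴ)ᴴ =
      V * ((permutationUnitary σ)ᴴ * diagonal (fun k => (v k : ℂ)) * permutationUnitary σ) * Vᴴ := by
    simp only [conjTranspose_mul, conjTranspose_conjTranspose, Matrix.mul_assoc,
      unitary_cancel_left_assoc hV]
  rw [h3, h2] at h1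
  exact h1

-- The control removes `H` and the block coherence, leaving the exchange equation with rate `γ`. Its
-- solution is the T-transform of parameter `(1 - exp (-2 γ t)) / 2`, which approaches `1 / 2`
-- without attaining it.
open scoped Matrix.Norms.L2Operator in
lemma tTransform_mem_of_lt_half {H : Matrix (Fin d) (Fin d) ℂ} (hH : H.IsHermitian)
    {L : ι → Matrix (Fin d) (Fin d) ℂ} (hone : dissipator L 1 = 0)
    {ρ V : Matrix (Fin d) (Fin d) ℂ} (hV : V ∈ unitaryGroup (Fin d) ℂ)
    (hVL : IsTwoLevel fun α => Vᴴ * L α * V) {i₀ i₁ : Fin d} (h0 : i₀.val = 0) (h1 : i₁.val = 1)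
    (hpos : 0 < transitionRate (fun α => Vᴴ * L α * V) i₀ i₁) {v : Fin d → ℝ}
    (hv : v ∈ reachableDiagonals (lindbladian H L) ρ V) {s : ℝ} (hs0 : 0 < s) (hs1 : s < 1 / 2) :
    tTransform i₀ i₁ s v ∈ reachableDiagonals (lindbladian H L) ρ V := by
  obtain ⟨K, hK, hKv⟩ := hVL.exists_control (dissipator_one_conj hone hV) h0 h1
  set γ := transitionRate (fun α => Vᴴ * L α * V) i₀ i₁ with hγ
  set A := controlledGenerator (lindbladian H L) (V * K * Vᴴ - H) with hA
  have hAapp : ∀ w : Fin d → ℝ, A (V * diagonal (fun k => (w k : ℂ)) * Vᴴ) =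
      V * diagonal (fun k => ((γ * (w (Equiv.swap i₀ i₁ k) - w k) : ℝ) : ℂ)) * Vᴴ := by
    intro w
    have e1 : V * K * Vᴴ = V * K * Vᴴ - H + H := by abel
    rw [hA, controlledGenerator_apply, lindbladian_apply, ← add_assoc, ← hamiltonianPart_add,
      ← e1, hamiltonianPart_conj _ hV, conj_conj_diagonal hV, dissipator_conj _ hV,
      ← Matrix.add_mul, ← Matrix.mul_add, hKv]
  set r : ℝ → ℝ := fun t => (1 - Real.exp (-(2 * γ * t))) / 2 with hr
  set x : ℝ → Matrix (Fin d) (Fin d) ℂ := fun t =>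
    V * diagonal (fun k => (tTransform i₀ i₁ (r t) v k : ℂ)) * Vᴴ with hx
  have hrd : ∀ t, HasDerivAt r (γ * (1 - 2 * r t)) t := by
    intro t
    have e1 : HasDerivAt (fun t : ℝ => -(2 * γ * t)) (-(2 * γ)) t := by
      have e0 := ((hasDerivAt_id t).const_mul (2 * γ)).neg
      rw [mul_one] at e0
      exact e0
    have e2 := (e1.exp.const_sub 1).div_const 2
    refine e2.congr_deriv ?_
    simp only [hr]
    ring
  have hxd : ∀ t, HasDerivAt x (A (x t)) t := by
    intro t
    rw [← hasDerivWithinAt_univ]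
    simp only [hx, hAapp]
    have key : HasDerivWithinAt
        (fun t => (diagonal fun k => (tTransform i₀ i₁ (r t) v k : ℂ) : Matrix (Fin d) (Fin d) ℂ))
        (diagonal fun k => ((γ * (tTransform i₀ i₁ (r t) v (Equiv.swap i₀ i₁ k) -
          tTransform i₀ i₁ (r t) v k) : ℝ) : ℂ)) univ t := by
      rw [hasDerivWithinAt_matrix]
      intro i j
      by_cases hij : i = j
      · subst hij
        simp only [diagonal_apply_eq]
        rw [hasDerivWithinAt_univ]
        have e1 : HasDerivAt (fun t => tTransform i₀ i₁ (r t) v i)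
            (γ * (tTransform i₀ i₁ (r t) v (Equiv.swap i₀ i₁ i) - tTransform i₀ i₁ (r t) v i)) t := by
          have e2 := (((hrd t).const_sub 1).mul_const (v i)).add
            ((hrd t).mul_const (v (Equiv.swap i₀ i₁ i)))
          refine e2.congr_deriv ?_
          simp only [tTransform, Equiv.swap_apply_self]
          ring
        exact e1.ofReal_comp
      · simp only [diagonal_apply_ne _ hij]
        exact hasDerivWithinAt_const _ _ _
    exact (key.const_mul V).mul_const Vᴴ
  have hKH : (V * K * Vᴴ - H).IsHermitian :=
    (isHermitian_mul_mul_conjTranspose V hK).sub hH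
  -- The solution of `r t = s`.
  set t := -Real.log (1 - 2 * s) / (2 * γ) with ht
  have htpos : 0 < t := by
    have : Real.log (1 - 2 * s) < 0 := Real.log_neg (by linarith) (by linarith)
    exact div_pos (by linarith) (by linarith)
  have hx0 : x 0 = V * diagonal (fun k => (v k : ℂ)) * Vᴴ := by
    simp [hx, hr, tTransform]
  have hrt : r t = s := by
    have e1 : -(2 * γ * t) = Real.log (1 - 2 * s) := by
      rw [ht]; field_simp
    simp only [hr]
    rw [e1, Real.exp_log (by linarith)]
    ring
  have hmem := flow_mem_closure (G := lindbladian H L) hKH htpos hv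
  rw [← hx0, linearFlow_eq_of_hasDerivAt _ hxd t] at hmem
  simp only [hx, hrt] at hmem
  exact hmem

/-- Permutations carry the pair `i, j` to the first two places and back, closedness adds the
endpoints `0` and `1 / 2`, and exchanging the two entries first turns `s` into `1 - s`. -/
lemma tTransform_mem_reachableDiagonals {H : Matrix (Fin d) (Fin d) ℂ} (hH : H.IsHermitian)
    {L : ι → Matrix (Fin d) (Fin d) ℂ} (hone : dissipator L 1 = 0)
    {ρ V : Matrix (Fin d) (Fin d) ℂ} (hV : V ∈ unitaryGroup (Fin d) ℂ)
    (hVL : IsTwoLevel fun α => Vᴴ * L α * V) {i₀ i₁ : Fin d} (h0 : i₀.val = 0) (h1 : i₁.val = 1)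
    (hpos : 0 < transitionRate (fun α => Vᴴ * L α * V) i₀ i₁) {v : Fin d → ℝ}
    (hv : v ∈ reachableDiagonals (lindbladian H L) ρ V) {i j : Fin d} (hij : i ≠ j) {s : ℝ}
    (hs0 : 0 ≤ s) (hs1 : s ≤ 1) : tTransform i j s v ∈ reachableDiagonals (lindbladian H L) ρ V := by
  have h01 : i₀ ≠ i₁ := fun h => by rw [h] at h0; omega
  set S := reachableDiagonals (lindbladian H L) ρ V with hS
  obtain ⟨σ, hσ0, hσ1⟩ := exists_perm_apply_pair h01 hij
  have hsmall : ∀ w ∈ S, ∀ r ∈ Ioo (0 : ℝ) (1 / 2), tTransform i j r w ∈ S := by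
    intro w hw r hr
    have e1 := tTransform_mem_of_lt_half hH hone hV hVL h0 h1 hpos
      (comp_perm_mem_reachableDiagonals hV σ hw) hr.1 hr.2
    have e2 := comp_perm_mem_reachableDiagonals hV σ.symm e1
    have e3 : tTransform i₀ i₁ r (w ∘ σ) ∘ σ.symm = tTransform i j r w := by
      funext k
      have e4 : σ (Equiv.swap i₀ i₁ (σ.symm k)) = Equiv.swap i j k := by
        rw [← hσ0, ← hσ1, Equiv.swap_apply_apply]
        simp [Equiv.Perm.mul_apply]
      simp [tTransform, e4]
    rwa [e3] at e2
  have hhalf : ∀ w ∈ S, ∀ r ∈ Icc (0 : ℝ) (1 / 2), tTransform i j r w ∈ S := by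
    intro w hw r hr
    have hc : Continuous fun r : ℝ => tTransform i j r w := by
      unfold tTransform
      fun_prop
    have hcl : IsClosed ((fun r : ℝ => tTransform i j r w) ⁻¹' S) :=
      (isClosed_reachableDiagonals _ _ _).preimage hc
    have hsub := hcl.closure_subset_iff.2 (fun r hr => hsmall w hw r hr)
    rw [closure_Ioo (by norm_num)] at hsub
    exact hsub hr
  rcases le_total s (1 / 2) with h | h
  · exact hhalf v hv s ⟨hs0, h⟩
  · have e1 := hhalf _ (comp_perm_mem_reachableDiagonals hV (Equiv.swap i j) hv) (1 - s)
      ⟨by linarith, by linarith⟩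
    have e2 : tTransform i j (1 - s) (v ∘ Equiv.swap i j) = tTransform i j s v := by
      funext k
      simp only [tTransform, Function.comp_apply, Equiv.swap_apply_self]
      ring
    rwa [e2] at e1

lemma sum_eq_one_of_conj_diagonal {ρ : QState d} {U : Matrix (Fin d) (Fin d) ℂ}
    (hU : U ∈ unitaryGroup (Fin d) ℂ) {v : Fin d → ℝ}
    (h : ρ.mat = U * diagonal (fun k => (v k : ℂ)) * Uᴴ) : ∑ i, v i = 1 := by
  have h1 := ρ.trace_eq_one
  rw [h, Matrix.trace_mul_comm, ← Matrix.mul_assoc, unitary_cancel_left hU, Matrix.one_mul,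
    trace_diagonal] at h1
  exact_mod_cast h1

/-- Unitary conjugations carry the eigenbasis of `ρ` to the basis `V` and finally `V` to the
eigenbasis of `σ`; in between only the spectrum changes, by T-transforms. -/
theorem HasTwoLevelForm.isOptimal {H : Matrix (Fin d) (Fin d) ℂ} (hH : H.IsHermitian)
    {L : ι → Matrix (Fin d) (Fin d) ℂ} (hone : dissipator L 1 = 0) (hne : dissipator L ≠ 0)
    (h : HasTwoLevelForm L) : IsOptimal (lindbladian H L) := by
  have hd := two_le_of_dissipator_ne_zero hone hne
  obtain ⟨V, hV, hVL, hpos⟩ := h.exists_positive_rate hd hone hne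
    (i₀ := ⟨0, by omega⟩) (i₁ := ⟨1, by omega⟩) rfl rfl
  intro ρ σ hmaj
  obtain ⟨U₁, hU₁, v, -, hρ, hvsum⟩ := ρ.posSemidef.isHermitian.exists_sorted_spectral
  obtain ⟨U₂, hU₂, w, hw, hσ, hwsum⟩ := σ.posSemidef.isHermitian.exists_sorted_spectral
  set S := reachableDiagonals (lindbladian H L) ρ.mat V with hS
  have hchange : ∀ {U W X : Matrix (Fin d) (Fin d) ℂ}, U ∈ unitaryGroup (Fin d) ℂ →
      W * Uᴴ * (U * X * Uᴴ) * (W * Uᴴ)ᴴ = W * X * Wᴴ := by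
    intro U W X hU
    simp only [conjTranspose_mul, conjTranspose_conjTranspose, Matrix.mul_assoc,
      unitary_cancel_left_assoc hU]
  have hvS : v ∈ S := by
    have e1 : ρ.mat ∈ closure (reachableSet (lindbladian H L) ρ.mat) :=
      subset_closure (mem_reachableSet_self _ _)
    have e2 := conj_mem_closure (mul_mem hV (conjTranspose_mem_unitary hU₁)) e1
    nth_rw 2 [hρ] at e2
    rwa [hchange hU₁] at e2
  have hwS : w ∈ S := by
    refine mem_of_majorizes (fun v hv i j hij s hs0 hs1 =>
      tTransform_mem_reachableDiagonals hH hone hV hVL rfl rfl hpos hv hij hs0 hs1) hw _ v hvS le_rfl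
      (fun m => ?_) ?_
    · rw [Finset.sum_sub_distrib, hvsum, hwsum, sub_nonneg]
      exact hmaj m
    · rw [Finset.sum_sub_distrib, sum_eq_one_of_conj_diagonal hU₁ hρ,
        sum_eq_one_of_conj_diagonal hU₂ hσ, sub_self]
  have e3 := conj_mem_closure (mul_mem hU₂ (conjTranspose_mem_unitary hV)) hwS
  rw [hchange hV, ← hσ] at e3
  exact e3

end Sufficiency

theorem mainTheorem1 {d : ℕ} {ι : Type*} [Fintype ι]
    (H : Matrix (Fin d) (Fin d) ℂ) (hH : H.IsHermitian)
    (L : ι → Matrix (Fin d) (Fin d) ℂ)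
    (hunital : IsUnital (lindbladian H L))
    (hne : dissipator L ≠ 0) :
    IsOptimal (lindbladian H L) ↔ HasTwoLevelForm L := by
  have hone := dissipator_one_of_isUnital hunital
  exact ⟨fun h => h.hasTwoLevelForm (two_le_of_dissipator_ne_zero hone hne) hH hone,
    fun h => h.isOptimal hH hone hne⟩
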